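/- **Setting.** Work in the upper half-space $\mathbb H^3=\{(\zeta,w)\in\mathbb C\times\mathbb R: w>0\}$ with metric $(|d\zeta|^2+dw^2)/w^2$ and asymptotic boundary $\bar{\mathbb C}=\mathbb C\cup\{\infty\}$. A *Bryant surface end* $E$ is given by its Bryant representation on a punctured disc $\Omega^*=\{0<|z|<r\}$: holomorphic functions $A,B,C,D$ on $\Omega^*$ with $AD-BC=1$, $A'D'-B'C'=0$ and $(A',B',C',D')\neq 0$ everywhere. It is the constant mean curvature one conformal immersion $$X=\left(\frac{\bar A C+\bar B D}{|A|^2+|B|^2},\ \frac1{|A|^2+|B|^2}\right):\Omega^*\to\mathbb H^3 .$$ Its Weierstrass data are $\omega=A\,dC-C\,dA$ and $g$ (the secondary Gauss map) with $g\,\omega=D\,dA-B\,dC$; its Hopf differential is $\omega\,dg$. *Horospherical ends.* $E$ is a *canonical horospherical end of asymptotic boundary $\infty$* if near $0$ one has $g=z^\mu$, $\omega=z^{-2}h(z)\,dz$ with an integer $\mu\ge 2$ and $h$ holomorphic, $h(0)\ne0$, and $A=f_2$, $B=\beta z^{2\mu-1}g_2$, $C=\gamma z^{-1}f_1$, $D=g_1$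 with $\beta,\gamma\in\mathbb C^*$ and $f_1,f_2,g_1,g_2$ holomorphic near $0$ with value $1$ at $0$. $E$ is a *horospherical end of asymptotic boundary $\mathcal B\in\bar{\mathbb C}$* if some isometry of $\mathbb H^3$ (direct or not) maps $\mathcal B$ to $\infty$ and $E$ to a canonical horospherical end of asymptotic boundary $\infty$ (up to a conformal change of parameter near the puncture). *Flux.* The flux through $E$ of a Killing field $Y$ is $\int_\Gamma\langle\eta,Y\rangle-2\int_K\langle\nu,Y\rangle$, where $\Gamma$ is a loop generating $\pi_1(E)$, $\eta$ its unit conormal towards the puncture, and $K$ a disc in $\mathbb H^3$ with boundary $\Gamma$; $\Gamma$ is oriented so that $(\Gamma',\eta,-\vec H)$ is direct, where $\vec H$ is the mean curvature vector, and $\nu$ is the unit normal to $K$ inducing this orientation on $\Gamma$. For all the Killing fields below it does not depend on $\Gamma$ and $K$. The *flux polynomial* of $E$ is $\Pi_E(X)=\varphi_2X^2+2\varphi_1X+\varphi_0$, where $\varphi_0=4\pi\operatorname{Res}_0(D\,dC-C\,dD)$, $\varphi_1=4\pi\operatorname{Res}_0(C\,dB-D\,dA)$, $\varphi_2=4\pi\operatorname{Res}_0(B\,dA-A\,dB)$.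 For $\mathcal C\ne\mathcal D$ in $\bar{\mathbb C}$, $(\mathcal C,\mathcal D)$ denotes the oriented geodesic from $\mathcal C$ to $\mathcal D$. **Theorem.** Let $\mathcal B\in\bar{\mathbb C}$ and let $E$ be a horospherical end of asymptotic boundary $\mathcal B$. There is a complex number $\kappa$ (the flux coefficient of $E$) such that: 1. If $\mathcal B\in\mathbb C$, then for all $\mathcal C\neq\mathcal D$ in $\bar{\mathbb C}$ the fluxes through $E$ of the Killing fields associated to the translation along, respectively the rotation about, the geodesic $(\mathcal C,\mathcal D)$ are $$-2\pi\operatorname{Re}\left(\kappa\frac{(\mathcal C-\mathcal B)(\mathcal D-\mathcal B)}{\mathcal C-\mathcal D}\right)\quad\text{and}\quad 2\pi\operatorname{Im}\left(\kappa\frac{(\mathcal C-\mathcal B)(\mathcal D-\mathcal B)}{\mathcal C-\mathcal D}\right)$$ (the fraction is read as its limit $-(\mathcal C-\mathcal B)$ if $\mathcal D=\infty$ and $\mathcal D-\mathcal B$ if $\mathcal C=\infty$), and $\Pi_E(X)=-2\pi\kappa(X-\mathcal B)^2$. 2. If $\mathcal B=\infty$, then for all $\mathcal C\neq\mathcal D$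 in $\bar{\mathbb C}$ these fluxes are $$-2\pi\operatorname{Re}\left(\frac{\kappa}{\mathcal C-\mathcal D}\right)\quad\text{and}\quad 2\pi\operatorname{Im}\left(\frac{\kappa}{\mathcal C-\mathcal D}\right)$$ (both zero if $\mathcal C=\infty$ or $\mathcal D=\infty$), and $\Pi_E(X)=-2\pi\kappa$. 3. $\kappa=0$ if and only if $\Pi_E=0$, if and only if the Hopf differential $\omega\,dg$ is holomorphic at $0$, if and only if the degree (local multiplicity, as a map to $\bar{\mathbb C}$) of the secondary Gauss map $g$ at $0$ is at least $3$. -/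

import Mathlib

open Complex Filter Topology
open scoped ComplexConjugate OnePoint MatrixGroups

noncomputable section

/-! ### Hyperbolic space

The upper half-space model: points `p = (ζ, w)` of `ℂ × ℝ` with `w > 0`, with the metric
`(|dζ|² + dw²) / w²`. Its asymptotic boundary is the Riemann sphere `OnePoint ℂ`. -/

namespace H3

/-- The underlying set of hyperbolic space in the upper half-space model. -/
def space : Set (ℂ × ℝ) := {p | 0 < p.2}

/-- The hyperbolic inner product of two tangent vectors at `p`. -/
def inner (p v₁ v₂ : ℂ × ℝ) : ℝ := ((conj v₁.1 * v₂.1).re + v₁.2 * v₂.2) / p.2 ^ 2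

/-- The hyperbolic norm of a tangent vector at `p`. -/
def norm (p v : ℂ × ℝ) : ℝ := Real.sqrt (inner p v v)

/-- The canonical volume form `(1 / w³) du ∧ dv ∧ dw` at `p`, where `ζ = u + i v`. -/
def vol (p v₁ v₂ v₃ : ℂ × ℝ) : ℝ :=
  Matrix.det !![v₁.1.re, v₁.1.im, v₁.2; v₂.1.re, v₂.1.im, v₂.2; v₃.1.re, v₃.1.im, v₃.2] / p.2 ^ 3

/-- The direct isometry of hyperbolic space which extends the Möbius transformation
`ζ ↦ (a ζ + b) / (c ζ + d)` of the asymptotic boundary, for an invertible matrix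
`P = !![a, b; c, d]`. -/
def mobius (P : Matrix (Fin 2) (Fin 2) ℂ) (p : ℂ × ℝ) : ℂ × ℝ :=
  let N : ℝ := ‖P 1 0 * p.1 + P 1 1‖ ^ 2 + ‖P 1 0‖ ^ 2 * p.2 ^ 2
  (((P 0 0 * p.1 + P 0 1) * conj (P 1 0 * p.1 + P 1 1)
      + P 0 0 * conj (P 1 0) * (p.2 : ℂ) ^ 2) / (N : ℂ),
    ‖P.det‖ * p.2 / N)

/-- The indirect isometry `(ζ, w) ↦ (conj ζ, w)`. Every indirect isometry is the composition
of this one with a direct isometry. -/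
def reflect (p : ℂ × ℝ) : ℂ × ℝ := (conj p.1, p.2)

/-- A matrix whose Möbius transformation maps `0` to `C` and `∞` to `D`
(for `C ≠ D`), hence maps the oriented geodesic `(0, ∞)` to the oriented geodesic `(C, D)`. -/
def axisMatrix : OnePoint ℂ → OnePoint ℂ → Matrix (Fin 2) (Fin 2) ℂ
  | OnePoint.some c, OnePoint.some d => !![d, c; 1, 1]
  | OnePoint.some c, OnePoint.infty => !![1, c; 0, 1]
  | OnePoint.infty, OnePoint.some d => !![d, 1; 1, 0]
  | OnePoint.infty, OnePoint.infty => 1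

theorem axisMatrix_det_ne_zero {C D : OnePoint ℂ} (h : C ≠ D) : (axisMatrix C D).det ≠ 0 := by
  induction C using OnePoint.rec <;> induction D using OnePoint.rec
  · exact absurd rfl h
  · simp [axisMatrix, Matrix.det_fin_two]
  · simp [axisMatrix, Matrix.det_fin_two]
  · rename_i c d
    have : d - c ≠ 0 := fun e => h (by rw [sub_eq_zero.mp e])
    simpa [axisMatrix, Matrix.det_fin_two] using this

theorem axisMatrix_smul {C D : OnePoint ℂ} (h : C ≠ D) (P : GL (Fin 2) ℂ)
    (hP : (P : Matrix (Fin 2) (Fin 2) ℂ) = axisMatrix C D) :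
    P • ((0 : ℂ) : OnePoint ℂ) = C ∧ P • (∞ : OnePoint ℂ) = D := by
  rw [OnePoint.smul_some_eq_ite, OnePoint.smul_infty_eq_ite, hP]
  induction C using OnePoint.rec <;> induction D using OnePoint.rec
  · exact absurd rfl h
  all_goals simp [axisMatrix]

/-- The translation of distance `t` along the oriented geodesic `(C, D)`: the conjugate of the
translation `(ζ, w) ↦ (eᵗ ζ, eᵗ w)` along `(0, ∞)`. -/
def translation (C D : OnePoint ℂ) (t : ℝ) (p : ℂ × ℝ) : ℂ × ℝ :=
  mobius (axisMatrix C D) (Real.exp t • mobius (axisMatrix C D)⁻¹ p)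

/-- The rotation of angle `θ`, in the direct sense, about the oriented geodesic `(C, D)`:
the conjugate of the rotation `(ζ, w) ↦ (e^{iθ} ζ, w)` about `(0, ∞)`. -/
def rotation (C D : OnePoint ℂ) (θ : ℝ) (p : ℂ × ℝ) : ℂ × ℝ :=
  let q := mobius (axisMatrix C D)⁻¹ p
  mobius (axisMatrix C D) (exp (θ * I) * q.1, q.2)

/-- The Killing field associated to the translation along `(C, D)`. -/
def translationField (C D : OnePoint ℂ) (p : ℂ × ℝ) : ℂ × ℝ :=
  deriv (fun t : ℝ => translation C D t p) 0

/-- The Killing field associated to the rotation about `(C, D)`. -/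
def rotationField (C D : OnePoint ℂ) (p : ℂ × ℝ) : ℂ × ℝ :=
  deriv (fun θ : ℝ => rotation C D θ p) 0

end H3

/-! ### Bryant surface ends -/

/-- A Bryant surface end, conformally parametrized by a punctured disc `0 < |z| < r`, given by its
Bryant representation `F = !![A, B; C, D]`, a holomorphic null immersion into `SL(2, ℂ)`. -/
structure BryantEnd where
  /-- The radius of the punctured disc. -/
  r : ℝ
  r_pos : 0 < r
  /-- The entries of the Bryant representation. -/
  A : ℂ → ℂ
  B : ℂ → ℂ
  C : ℂ → ℂ
  D : ℂ → ℂ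
  holA : DifferentiableOn ℂ A (Metric.ball 0 r \ {0})
  holB : DifferentiableOn ℂ B (Metric.ball 0 r \ {0})
  holC : DifferentiableOn ℂ C (Metric.ball 0 r \ {0})
  holD : DifferentiableOn ℂ D (Metric.ball 0 r \ {0})
  det_eq : ∀ z ∈ Metric.ball (0 : ℂ) r \ {0}, A z * D z - B z * C z = 1
  null : ∀ z ∈ Metric.ball (0 : ℂ) r \ {0}, deriv A z * deriv D z - deriv B z * deriv C z = 0
  immersion : ∀ z ∈ Metric.ball (0 : ℂ) r \ {0},
    ¬ (deriv A z = 0 ∧ deriv B z = 0 ∧ deriv C z = 0 ∧ deriv D z = 0)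

namespace BryantEnd

variable (E : BryantEnd)

/-- The conformal immersion of the end into the upper half-space. It has constant mean curvature
one, and `(∂X/∂x, ∂X/∂y, H)` is direct, where `z = x + i y` and `H` is the mean curvature
vector. -/
def X (z : ℂ) : ℂ × ℝ :=
  ((conj (E.A z) * E.C z + conj (E.B z) * E.D z) / ((‖E.A z‖ ^ 2 + ‖E.B z‖ ^ 2 : ℝ) : ℂ),
    1 / (‖E.A z‖ ^ 2 + ‖E.B z‖ ^ 2))

/-! The Weierstrass data `(g, ω)` are given by `F⁻¹ dF = !![g, -g²; 1, -g] ω`. -/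

/-- The coefficient of `dz` in the one-form `ω = A dC - C dA`. -/
def omega (z : ℂ) : ℂ := E.A z * deriv E.C z - E.C z * deriv E.A z

/-- The secondary Gauss map `g`, where `g ω = D dA - B dC`. -/
def gauss (z : ℂ) : ℂ := (E.D z * deriv E.A z - E.B z * deriv E.C z) / E.omega z

/-- The coefficient of `dz²` in the Hopf differential `ω dg`. -/
def hopf (z : ℂ) : ℂ := E.omega z * deriv E.gauss z

/-- The Hopf differential is holomorphic at zero: it agrees near zero with a
function that is holomorphic in a full neighbourhood of zero. -/
def HopfHolomorphicAtZero : Prop :=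
  ∃ q : ℂ → ℂ, AnalyticAt ℂ q 0 ∧ ∀ᶠ z in 𝓝[≠] (0 : ℂ), E.hopf z = q z

/-! ### Horospherical ends -/

/-- Canonical horospherical ends of asymptotic boundary `∞`: near zero
the Weierstrass data are `g = z ^ μ`, `ω = z⁻² h(z) dz` with `μ ≥ 2`, `h(0) ≠ 0`, and the Bryant
representation is `!![f₂, b z^(2μ-1) g₂; c z⁻¹ f₁, g₁]`, the functions
`f₁`, `f₂`, `g₁`, `g₂` being holomorphic near zero with value `1` at zero. -/
def IsCanonicalHorospherical : Prop :=
  ∃ (μ : ℕ) (h f₁ f₂ g₁ g₂ : ℂ → ℂ) (b c : ℂ),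
    2 ≤ μ ∧ b ≠ 0 ∧ c ≠ 0 ∧
    AnalyticAt ℂ h 0 ∧ h 0 ≠ 0 ∧
    AnalyticAt ℂ f₁ 0 ∧ f₁ 0 = 1 ∧ AnalyticAt ℂ f₂ 0 ∧ f₂ 0 = 1 ∧
    AnalyticAt ℂ g₁ 0 ∧ g₁ 0 = 1 ∧ AnalyticAt ℂ g₂ 0 ∧ g₂ 0 = 1 ∧
    ∀ᶠ z in 𝓝[≠] (0 : ℂ),
      E.gauss z = z ^ μ ∧ E.omega z = (z ^ 2)⁻¹ * h z ∧
      E.A z = f₂ z ∧ E.B z = b * z ^ (2 * μ - 1) * g₂ z ∧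
      E.C z = c * z⁻¹ * f₁ z ∧ E.D z = g₁ z

/-- Horospherical ends of asymptotic boundary `B`: some isometry `Ψ`, direct or not, maps `B` to
`∞` and the end to a canonical horospherical end of asymptotic boundary `∞`, up to a conformal
change of parameter near the puncture. -/
def IsHorospherical (B : OnePoint ℂ) : Prop :=
  ∃ E₀ : BryantEnd, E₀.IsCanonicalHorospherical ∧
  ∃ (P : SL(2, ℂ)) (φ : ℂ → ℂ), AnalyticAt ℂ φ 0 ∧ φ 0 = 0 ∧ deriv φ 0 ≠ 0 ∧
    (((P : GL (Fin 2) ℂ) • B = ∞ ∧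
        ∀ᶠ z in 𝓝[≠] (0 : ℂ), H3.mobius P (E.X (φ z)) = E₀.X z) ∨
      ((P : GL (Fin 2) ℂ) • OnePoint.map (starRingEnd ℂ) B = ∞ ∧
        ∀ᶠ z in 𝓝[≠] (0 : ℂ), H3.mobius P (H3.reflect (E.X (φ z))) = E₀.X (conj z)))

/-! ### The flux of a Killing field -/

/-- A loop in the punctured disc which generates the fundamental group of the end: a smooth
regular closed curve with winding number one about zero. -/
structure IsGenerator (γ : ℝ → ℂ) : Prop where
  smooth : ContDiff ℝ ((⊤ : ℕ∞) : WithTop ℕ∞) γ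
  periodic : Function.Periodic γ (2 * Real.pi)
  regular : ∀ τ, deriv γ τ ≠ 0
  mem : ∀ τ, γ τ ∈ Metric.ball (0 : ℂ) E.r \ {0}
  winding : ∫ τ in (0 : ℝ)..2 * Real.pi, deriv γ τ / γ τ = 2 * Real.pi * I

/-- The unit conormal to the curve `X ∘ γ` pointing towards the puncture: `γ` turns
counterclockwise about zero, so zero is on the side of `i γ'`. -/
def conormal (γ : ℝ → ℂ) (τ : ℝ) : ℂ × ℝ :=
  let v := fderiv ℝ E.X (γ τ) (I * deriv γ τ)
  (H3.norm (E.X (γ τ)) v)⁻¹ • v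

/-- `∫_Γ ⟨η, Y⟩`, integrated with respect to arc length, where `Γ = X ∘ γ` and `η` is
its conormal. -/
def conormalIntegral (Y : ℂ × ℝ → ℂ × ℝ) (γ : ℝ → ℂ) : ℝ :=
  ∫ τ in (0 : ℝ)..2 * Real.pi,
    H3.inner (E.X (γ τ)) (E.conormal γ τ) (Y (E.X (γ τ))) *
      H3.norm (E.X (γ τ)) (fderiv ℝ E.X (γ τ) (deriv γ τ))

/-- A smooth disc `K` in hyperbolic space with boundary `Γ = X ∘ γ`, parametrized by the closed
unit disc. The orientation of `Γ` for which `(Γ', η, -H)` is direct is the one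
opposite to that of `γ`, and `K` is parametrized so that its boundary has this orientation. -/
structure IsSpanningDisc (γ : ℝ → ℂ) (K : ℂ → ℂ × ℝ) : Prop where
  smooth : ContDiff ℝ ((⊤ : ℕ∞) : WithTop ℕ∞) K
  mem : ∀ z ∈ Metric.closedBall (0 : ℂ) 1, K z ∈ H3.space
  boundary : ∀ τ : ℝ, K (exp (-(τ * I))) = E.X (γ τ)

/-- `∫_K ⟨ν, Y⟩`, integrated with respect to area, where the unit normal `ν` is such that
`(∂K/∂x, ∂K/∂y, ν)` is direct: `⟨ν, Y⟩` times the area element is `vol (∂K/∂x, ∂K/∂y, Y)`. -/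
def discIntegral (Y : ℂ × ℝ → ℂ × ℝ) (K : ℂ → ℂ × ℝ) : ℝ :=
  ∫ z in Metric.ball (0 : ℂ) 1, H3.vol (K z) (fderiv ℝ K z 1) (fderiv ℝ K z I) (Y (K z))

/-- The flux of `Y` through the end is `a`: the number `∫_Γ ⟨η, Y⟩ - 2 ∫_K ⟨ν, Y⟩` is equal to `a`
for all choices of `Γ` and `K` (and such choices exist). -/
def HasFlux (Y : ℂ × ℝ → ℂ × ℝ) (a : ℝ) : Prop :=
  (∃ γ K, E.IsGenerator γ ∧ E.IsSpanningDisc γ K) ∧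
  ∀ γ K, E.IsGenerator γ → E.IsSpanningDisc γ K →
    E.conormalIntegral Y γ - 2 * discIntegral Y K = a

/-! ### The flux polynomial -/

/-- The residue at zero of `f dz`, for `f` holomorphic in the punctured disc. -/
def residue (f : ℂ → ℂ) : ℂ := (2 * Real.pi * I)⁻¹ * ∮ z in C(0, E.r / 2), f z

/-- `φ₀ = 4π Res (D dC - C dD)` -/
def phi0 : ℂ := 4 * Real.pi * E.residue fun z => E.D z * deriv E.C z - E.C z * deriv E.D z

/-- `φ₁ = 4π Res (C dB - D dA)` -/
def phi1 : ℂ := 4 * Real.pi * E.residue fun z => E.C z * deriv E.B z - E.D z * deriv E.A z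

/-- `φ₂ = 4π Res (B dA - A dB)` -/
def phi2 : ℂ := 4 * Real.pi * E.residue fun z => E.B z * deriv E.A z - E.A z * deriv E.B z

/-- The flux polynomial `φ₂ X² + 2 φ₁ X + φ₀`. -/
def fluxPolynomial : Polynomial ℂ :=
  Polynomial.C E.phi2 * Polynomial.X ^ 2 + Polynomial.C (2 * E.phi1) * Polynomial.X
    + Polynomial.C E.phi0

end BryantEnd

/-- `g`, as a meromorphic map to the Riemann sphere, has degree (local multiplicity) `n` at zero:
either `g` has a pole of order `n`, or `g - c` has a zero of order `n` for some constant `c`. -/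
def HasDegreeAtZero (g : ℂ → ℂ) (n : ℕ) : Prop :=
  0 < n ∧ (meromorphicOrderAt g 0 = ((-(n : ℤ) : ℤ) : WithTop ℤ) ∨
    ∃ c : ℂ, meromorphicOrderAt (fun z => g z - c) 0 = ((n : ℤ) : WithTop ℤ))

/-- The number `(C - B) (D - B) / (C - D)`, with its limit value if `C = ∞` or `D = ∞`;
if `B = ∞` it is replaced by `1 / (C - D)`, which is zero if `C = ∞` or `D = ∞`.
It is used for `C ≠ D` only. -/
def fluxKernel : OnePoint ℂ → OnePoint ℂ → OnePoint ℂ → ℂ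
  | OnePoint.some b, OnePoint.some c, OnePoint.some d => (c - b) * (d - b) / (c - d)
  | OnePoint.some b, OnePoint.some c, OnePoint.infty => -(c - b)
  | OnePoint.some b, OnePoint.infty, OnePoint.some d => d - b
  | OnePoint.infty, OnePoint.some c, OnePoint.some d => 1 / (c - d)
  | _, _, _ => 0

end

/-! The flux is the residue of a holomorphic form. A Killing field $Y$ is an element of
$\mathfrak{sl}_2(\mathbb C)$, and multiplying it by $i$ gives a field whose dual one-form $\alpha$
satisfies $d\alpha = 2\,\iota_Y\mathrm{vol}$ (`dualFormDeriv_antisymm`). By Stokes, the disc term of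
the flux becomes an integral of $\alpha$ over the boundary loop. As the immersion is conformal, the
conormal term is the integral of $\langle dX(i\gamma'),Y\rangle$. In the sum of the two integrands
the antilinear parts cancel, leaving twice the imaginary part of `fluxForm`, a linear combination of
the entries of $dF\,F^{-1}$ (`inner_add_dualForm_eq_fluxForm`). So the flux is $4\pi$ times the real
part of a residue (`hasFlux_of_fluxForm_eq`).

It remains to compute residues. The immersion determines $F$ up to a right factor in $SU(2)$ at each
point; along a holomorphic family this factor is both holomorphic and antiholomorphic, hence
constant (`unitary_of_bryantPoint_eq`, `eventually_eq_const_of_conj`). A horospherical end is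
therefore a canonical one multiplied on the left by a matrix of $SL_2(\mathbb C)$ and on the right
by a constant unitary matrix, up to reparametrization. Indirect isometries reduce to direct ones by
conjugating the end. The right factor disappears from $dF\,F^{-1}$, and the left one acts by
conjugation.

For a canonical end only `form₀` has a pole. It is double, and its residue $\rho$ is a nonzero
constant if $\mu=2$ and zero if $\mu\ge 3$, as follows from $dD=-g\,dC$ (`exists_expansions`). If
the isometry has bottom row $(s,t)$, the residues of the three forms become $s^2\rho$, $st\rho$,
$t^2\rho$, so the flux polynomial is $4\pi\rho(sX+t)^2$. Its root is the boundary point sent to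
$\infty$, and $\kappa$ is $-2\rho s^2$ (finite boundary point) or $-2\rho t^2$ (boundary point
$\infty$). Fluxes are read off by evaluating the holomorphic vector field of the axis at that point.
The same local form shows that the Hopf differential has order $\mu-3$ and that $g$ has degree $\mu$
at the puncture. -/

noncomputable section

/-! ### Killing fields of the upper half-space and their dual one-forms. -/

namespace H3

/-- The Killing field of hyperbolic space which extends the holomorphic vector field
`b + 2 a ζ - c ζ²` of the asymptotic boundary. -/
def killing (a b c : ℂ) (p : ℂ × ℝ) : ℂ × ℝ :=
  (b + 2 * a * p.1 - c * p.1 ^ 2 + conj c * (p.2 : ℂ) ^ 2, 2 * p.2 * (a - c * p.1).re)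

theorem mobius_denom_pos {P : Matrix (Fin 2) (Fin 2) ℂ} (hP : P.det ≠ 0) {p : ℂ × ℝ}
    (hp : p ∈ space) :
    0 < ‖P 1 0 * p.1 + P 1 1‖ ^ 2 + ‖P 1 0‖ ^ 2 * p.2 ^ 2 := by
  have hp' : 0 < p.2 := hp
  by_cases h : P 1 0 = 0
  · have : P 1 1 ≠ 0 := by
      rintro h'
      exact hP (by rw [Matrix.det_fin_two, h, h']; ring)
    rw [h]
    have := norm_pos_iff.mpr this
    simp
    positivity
  · have := norm_pos_iff.mpr h
    positivity

theorem ofReal_norm_sq (z : ℂ) : ((‖z‖ ^ 2 : ℝ) : ℂ) = z * conj z := by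
  rw [Complex.mul_conj']; push_cast; rfl

/-- Translations and rotations about an axis are threefold compositions. The action property turns
each into a single curve of matrices, which can then be differentiated at the identity. -/
theorem mobius_mul {P Q : Matrix (Fin 2) (Fin 2) ℂ} (hQ : Q.det ≠ 0) {p : ℂ × ℝ}
    (hp : p ∈ space) : mobius (P * Q) p = mobius P (mobius Q p) := by
  have hN := mobius_denom_pos hQ hp
  have hd : ((‖Q.det‖ ^ 2 : ℝ) : ℂ) = Q.det * conj Q.det := ofReal_norm_sq _
  rw [Matrix.det_fin_two] at hd
  have hmd : ‖(P * Q).det‖ = ‖P.det‖ * ‖Q.det‖ := by rw [Matrix.det_mul, norm_mul]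
  obtain ⟨ζ, w⟩ := p
  unfold mobius
  simp only [hmd]
  simp only [Matrix.mul_apply, Fin.sum_univ_two, Matrix.det_fin_two Q] at hN ⊢
  generalize P 0 0 = a, P 0 1 = b, P 1 0 = c, P 1 1 = d at *
  generalize Q 0 0 = e, Q 0 1 = f, Q 1 0 = g, Q 1 1 = h at *
  generalize ‖P.det‖ = δP
  generalize ‖e * h - f * g‖ = δ at *
  set N : ℝ := ‖g * ζ + h‖ ^ 2 + ‖g‖ ^ 2 * w ^ 2 with hNdef
  have hNc : (N : ℂ) = (g * ζ + h) * conj (g * ζ + h) + g * conj g * (w : ℂ) ^ 2 := by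
    rw [hNdef, Complex.ofReal_add, Complex.ofReal_mul, ofReal_norm_sq, ofReal_norm_sq]
    push_cast; rfl
  have hN0 : (N : ℂ) ≠ 0 := by exact_mod_cast hN.ne'
  set Z : ℂ := ((e * ζ + f) * conj (g * ζ + h) + e * conj g * (w : ℂ) ^ 2) / (N : ℂ) with hZ
  have hZN : Z * N = (e * ζ + f) * conj (g * ζ + h) + e * conj g * (w : ℂ) ^ 2 := by
    rw [hZ]; field_simp
  have hZN' : conj Z * N = conj ((e * ζ + f) * conj (g * ζ + h) + e * conj g * (w : ℂ) ^ 2) := by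
    rw [← hZN]; simp
  set W : ℝ := δ * w / N with hW
  have hWN : (W : ℂ) * N = δ * w := by rw [hW]; push_cast; field_simp
  set M : ℝ := ‖c * Z + d‖ ^ 2 + ‖c‖ ^ 2 * W ^ 2 with hM
  have hMc : (M : ℂ) = (c * Z + d) * conj (c * Z + d) + c * conj c * (W : ℂ) ^ 2 := by
    rw [hM, Complex.ofReal_add, Complex.ofReal_mul, ofReal_norm_sq, ofReal_norm_sq]
    push_cast; rfl
  -- Companion of the formula for `N` with the top row of `Q` in place of the bottom row. It
  -- supplies the quadratic term when the denominator of the composite is expanded.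
  have hZZ : (Z * conj Z + (W : ℂ) ^ 2) * N
      = (e * ζ + f) * conj (e * ζ + f) + e * conj e * (w : ℂ) ^ 2 := by
    apply mul_right_cancel₀ hN0
    have : (Z * conj Z + (W : ℂ) ^ 2) * N * N = (Z * N) * (conj Z * N) + (W * N) ^ 2 := by ring
    rw [this, hZN, hZN', hWN, hNc]
    simp only [map_add, map_mul, map_pow, Complex.conj_conj, Complex.conj_ofReal, map_sub] at hd ⊢
    push_cast at hd
    linear_combination (w : ℂ) ^ 2 * hd
  have hK : ((‖(c * e + d * g) * ζ + (c * f + d * h)‖ ^ 2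
      + ‖c * e + d * g‖ ^ 2 * w ^ 2 : ℝ) : ℂ) = M * N := by
    rw [Complex.ofReal_add, Complex.ofReal_mul, ofReal_norm_sq, ofReal_norm_sq, hMc]
    simp only [map_add, map_mul, map_pow, Complex.conj_conj, Complex.conj_ofReal]
      at hZZ hZN hZN' hNc ⊢
    push_cast
    linear_combination -c * conj c * hZZ - c * conj d * hZN - conj c * d * hZN' - d * conj d * hNc
  have hKr : ‖(c * e + d * g) * ζ + (c * f + d * h)‖ ^ 2
      + ‖c * e + d * g‖ ^ 2 * w ^ 2 = M * N := by exact_mod_cast hK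
  rw [hKr]
  refine Prod.ext ?_ ?_
  · show _ / _ = _ / _
    rw [Complex.ofReal_mul, ← mul_div_mul_right _ (M : ℂ) hN0]
    congr 1
    simp only [map_add, map_mul, map_pow, Complex.conj_conj, Complex.conj_ofReal]
      at hZZ hZN hZN' hNc ⊢
    linear_combination -a * conj c * hZZ - a * conj d * hZN - b * conj c * hZN' - b * conj d * hNc
  · show _ / _ = _ / _
    rw [← mul_div_mul_right _ M hN.ne']
    congr 1
    have : W * N = δ * w := by exact_mod_cast hWN
    linear_combination -δP * this

theorem mobius_diag (l : ℂ) (p : ℂ × ℝ) :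
    mobius !![l, 0; 0, 1] p = (l * p.1, ‖l‖ * p.2) := by
  simp [mobius, Matrix.det_fin_two]

/-- Scalar matrices act with no first-order effect, so only the traceless part of `G'` survives;
this is why half the difference of the diagonal entries appears. -/
theorem hasDerivAt_mobius {G : ℝ → Matrix (Fin 2) (Fin 2) ℂ} {G' : Matrix (Fin 2) (Fin 2) ℂ}
    (hG : ∀ i j, HasDerivAt (fun t => G t i j) (G' i j) 0) (h0 : G 0 = 1) (p : ℂ × ℝ) :
    HasDerivAt (fun t => mobius (G t) p)
      (killing ((G' 0 0 - G' 1 1) / 2) (G' 0 1) (G' 1 0) p) 0 := by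
  obtain ⟨ζ, w⟩ := p
  have e00 : G 0 0 0 = 1 := by simp [h0]
  have e01 : G 0 0 1 = 0 := by simp [h0]
  have e10 : G 0 1 0 = 0 := by simp [h0]
  have e11 : G 0 1 1 = 1 := by simp [h0]
  have hn : ∀ {f : ℝ → ℂ} {f' : ℂ}, HasDerivAt f f' 0 →
      HasDerivAt (fun t => ‖f t‖ ^ 2) (2 * (conj (f 0) * f').re) 0 := by
    intro f f' hf
    have := hf.norm_sq
    rw [Complex.inner] at this
    simpa [mul_comm] using this
  have hc : ∀ {f : ℝ → ℂ} {f' : ℂ}, HasDerivAt f f' 0 →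
      HasDerivAt (fun t => conj (f t)) (conj f') 0 := fun hf => hf.star
  have hden := (((hG 1 0).mul_const ζ).add (hG 1 1))
  have hN := (hn hden).add ((hn (hG 1 0)).mul_const (w ^ 2))
  have hnum := ((((hG 0 0).mul_const ζ).add (hG 0 1)).mul (hc hden)).add
    (((hG 0 0).mul (hc (hG 1 0))).mul_const ((w : ℂ) ^ 2))
  have hdet : HasDerivAt (fun t => ‖(G t).det‖) ((G' 0 0 + G' 1 1).re) 0 := by
    have h1 : HasDerivAt (fun t => (G t).det) (G' 0 0 + G' 1 1) 0 := by
      simp only [Matrix.det_fin_two]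
      refine (((hG 0 0).mul (hG 1 1)).sub ((hG 0 1).mul (hG 1 0))).congr_deriv ?_
      simp [e00, e01, e10, e11]
    have h2 : HasDerivAt (fun t => √(‖(G t).det‖ ^ 2)) _ 0 := (hn h1).sqrt (by simp [h0])
    rw [funext fun t => Real.sqrt_sq (norm_nonneg (G t).det)] at h2
    convert h2 using 1
    simp [h0]
  have hd0 : ‖(G 0).det‖ = 1 := by simp [h0]
  unfold mobius
  refine HasDerivAt.prodMk ?_ ?_
  · refine (hnum.div hN.ofReal_comp ?_).congr_deriv ?_
    · simp [e10, e11]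
    · simp [e00, e01, e10, e11]
      apply Complex.ext <;> simp [pow_two] <;> ring
  · refine ((hdet.mul_const w).div hN ?_).congr_deriv ?_
    · simp [e10, e11]
    · simp [e10, e11, hd0]
      ring

/-- The coefficients are the traceless part of the conjugate of $\mathrm{diag}(l',0)$ by `P`.
Translations have $l'=1$ and rotations $l'=i$, so the two Killing fields of an axis differ by the
factor $i$. -/
theorem hasDerivAt_mobius_conj {P : Matrix (Fin 2) (Fin 2) ℂ} (hP : P.det ≠ 0) {l : ℝ → ℂ} {l' : ℂ}
    (hl : HasDerivAt l l' 0) (hl0 : l 0 = 1) (p : ℂ × ℝ) :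
    HasDerivAt (fun t => mobius (P * !![l t, 0; 0, 1] * P⁻¹) p)
      (killing (l' * ((P 0 0 * P 1 1 + P 0 1 * P 1 0) / (2 * P.det))) (l' * (-(P 0 0 * P 0 1) / P.det))
        (l' * (P 1 0 * P 1 1 / P.det)) p) 0 := by
  have key : ∀ t, P * !![l t, 0; 0, 1] * P⁻¹ =
      P.det⁻¹ • !![l t * (P 0 0 * P 1 1) - P 0 1 * P 1 0, P 0 0 * P 0 1 - l t * (P 0 0 * P 0 1);
        l t * (P 1 0 * P 1 1) - P 1 0 * P 1 1, P 0 0 * P 1 1 - l t * (P 0 1 * P 1 0)] := by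
    intro t
    rw [Matrix.inv_def, Ring.inverse_eq_inv', Matrix.mul_smul]
    congr 1
    rw [Matrix.adjugate_fin_two]
    ext i j
    fin_cases i <;> fin_cases j <;> simp [Matrix.mul_apply, Fin.sum_univ_two] <;> ring
  have h0 : P * !![l 0, 0; 0, 1] * P⁻¹ = 1 := by
    have : (!![l 0, 0; 0, 1] : Matrix (Fin 2) (Fin 2) ℂ) = 1 := by
      rw [hl0]; exact Matrix.one_fin_two.symm
    rw [this, mul_one, Matrix.mul_nonsing_inv _ (isUnit_iff_ne_zero.mpr hP)]
  have := hasDerivAt_mobius (G := fun t => P * !![l t, 0; 0, 1] * P⁻¹)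
    (G' := P.det⁻¹ • !![l' * (P 0 0 * P 1 1), - (l' * (P 0 0 * P 0 1));
        l' * (P 1 0 * P 1 1), - (l' * (P 0 1 * P 1 0))]) ?_ h0 p
  · convert this using 2 <;> simp <;> field_simp
  · intro i j
    simp only [key]
    fin_cases i <;> fin_cases j <;> simp
    · exact ((hl.mul_const _).sub_const _).const_mul _
    · simpa using ((hl.mul_const _).const_sub _).const_mul _
    · exact ((hl.mul_const _).sub_const _).const_mul _
    · simpa using ((hl.mul_const _).const_sub _).const_mul _

theorem mobius_conj_diag {P : Matrix (Fin 2) (Fin 2) ℂ} (hP : P.det ≠ 0) {l : ℂ} (hl : l ≠ 0)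
    {p : ℂ × ℝ} (hp : p ∈ space) :
    mobius P (l * (mobius P⁻¹ p).1, ‖l‖ * (mobius P⁻¹ p).2) =
      mobius (P * !![l, 0; 0, 1] * P⁻¹) p := by
  have hPi : (P⁻¹).det ≠ 0 := by
    rw [Matrix.det_nonsing_inv, Ring.inverse_eq_inv']; exact inv_ne_zero hP
  rw [mul_assoc, mobius_mul _ hp, mobius_mul hPi hp, mobius_diag]
  rw [Matrix.det_mul]
  exact mul_ne_zero (by simpa [Matrix.det_fin_two] using hl) hPi

/-- The matrix entries `(a, b, c)` of the Killing field of the translation along `(C, D)`. -/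
def axisCoeff (C D : OnePoint ℂ) : ℂ × ℂ × ℂ :=
  let P := axisMatrix C D
  ((P 0 0 * P 1 1 + P 0 1 * P 1 0) / (2 * P.det), -(P 0 0 * P 0 1) / P.det, P 1 0 * P 1 1 / P.det)

theorem translationField_eq {C D : OnePoint ℂ} (h : C ≠ D) {p : ℂ × ℝ} (hp : p ∈ space) :
    translationField C D p =
      killing (axisCoeff C D).1 (axisCoeff C D).2.1 (axisCoeff C D).2.2 p := by
  have hP := axisMatrix_det_ne_zero h
  have hl : HasDerivAt (fun t : ℝ => ((Real.exp t : ℝ) : ℂ)) 1 0 := by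
    have := (Real.hasDerivAt_exp 0).ofReal_comp
    simpa using this
  have := hasDerivAt_mobius_conj hP hl (by simp) p
  simp only [one_mul] at this
  refine Eq.trans ?_ this.deriv
  unfold translationField
  congr 1
  funext t
  rw [← mobius_conj_diag hP (by exact_mod_cast (Real.exp_pos t).ne') hp]
  unfold translation
  congr 1
  refine Prod.ext ?_ ?_
  · simp
  · rw [Complex.norm_real, Real.norm_of_nonneg (Real.exp_pos t).le]
    rfl

theorem rotationField_eq {C D : OnePoint ℂ} (h : C ≠ D) {p : ℂ × ℝ} (hp : p ∈ space) :
    rotationField C D p =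
      killing (I * (axisCoeff C D).1) (I * (axisCoeff C D).2.1) (I * (axisCoeff C D).2.2) p := by
  have hP := axisMatrix_det_ne_zero h
  have hl : HasDerivAt (fun t : ℝ => exp (t * I)) I 0 := by
    have := (((hasDerivAt_id (0 : ℝ)).ofReal_comp).mul_const I).cexp
    simpa using this
  have := (hasDerivAt_mobius_conj hP hl (by simp) p).deriv
  refine Eq.trans ?_ this
  unfold rotationField
  congr 1
  funext t
  rw [← mobius_conj_diag hP (Complex.exp_ne_zero _) hp]
  unfold rotation
  simp [Complex.norm_exp_ofReal_mul_I]

/-- The differential of `killing a b c` at `p` in the direction `v`. -/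
def killingDeriv (a c : ℂ) (p v : ℂ × ℝ) : ℂ × ℝ :=
  (2 * a * v.1 - 2 * c * p.1 * v.1 + 2 * conj c * p.2 * v.2,
    2 * v.2 * (a - c * p.1).re - 2 * p.2 * (c * v.1).re)

/-- The one-form dual to the Killing field `killing (I * a) (I * b) (I * c)`, whose exterior
derivative is twice the contraction of the volume form by `killing a b c`. -/
def dualForm (a b c : ℂ) (p v : ℂ × ℝ) : ℝ :=
  inner p v (killing (I * a) (I * b) (I * c) p)

/-- The derivative of `dualForm a b c` at `p` in the direction `v`. -/
def dualFormDeriv (a b c : ℂ) (p v u : ℂ × ℝ) : ℝ :=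
  inner p u (killingDeriv (I * a) (I * c) p v) - 2 * v.2 / p.2 * dualForm a b c p u

/-- The pointwise form of $d\alpha = 2\,\iota_Y\mathrm{vol}$, which lets Stokes' theorem eliminate
the spanning disc. -/
theorem dualFormDeriv_antisymm (a b c : ℂ) {p : ℂ × ℝ} (hp : p ∈ space) (v u : ℂ × ℝ) :
    dualFormDeriv a b c p v u - dualFormDeriv a b c p u v = 2 * vol p v u (killing a b c p) := by
  have hp' : p.2 ≠ 0 := ne_of_gt hp
  obtain ⟨ζ, w⟩ := p
  obtain ⟨v₁, v₂⟩ := v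
  obtain ⟨u₁, u₂⟩ := u
  simp only at hp'
  simp [dualFormDeriv, dualForm, vol, inner, killing, killingDeriv, Matrix.det_fin_three, pow_two]
  field_simp
  ring

theorem hasDerivAt_dualForm (a b c : ℂ) {k m : ℝ → ℂ × ℝ} {v n : ℂ × ℝ}
    (hk : HasDerivAt k v 0) (hm : HasDerivAt m n 0) (h0 : k 0 ∈ space) :
    HasDerivAt (fun s => dualForm a b c (k s) (m s))
      (dualFormDeriv a b c (k 0) v (m 0) + dualForm a b c (k 0) n) 0 := by
  have hw : (k 0).2 ≠ 0 := ne_of_gt h0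
  have hk1 : HasDerivAt (fun s => (k s).1) v.1 0 := hk.fst
  have hk2 : HasDerivAt (fun s => (k s).2) v.2 0 := hk.snd
  have hm1 : HasDerivAt (fun s => (m s).1) n.1 0 := hm.fst
  have hm2 : HasDerivAt (fun s => (m s).2) n.2 0 := hm.snd
  have hre : ∀ {f : ℝ → ℂ} {f' : ℂ}, HasDerivAt f f' 0 →
      HasDerivAt (fun t => (f t).re) f'.re 0 := fun hf =>
    (Complex.reCLM.hasFDerivAt.comp_hasDerivAt 0 hf)
  have hc : ∀ {f : ℝ → ℂ} {f' : ℂ}, HasDerivAt f f' 0 →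
      HasDerivAt (fun t => conj (f t)) (conj f') 0 := fun hf => hf.star
  have hZ1 := (((hk1.const_mul (2 * (I * a))).const_add (I * b)).sub
    ((hk1.pow 2).const_mul (I * c))).add ((hk2.ofReal_comp.pow 2).const_mul (conj (I * c)))
  have hZ2 := (hk2.const_mul 2).mul (hre ((hk1.const_mul (I * c)).const_sub (I * a)))
  have := ((hre ((hc hm1).mul hZ1)).add (hm2.mul hZ2)).div (hk2.pow 2) (pow_ne_zero 2 hw)
  refine this.congr_deriv ?_
  simp only [Pi.add_apply, Pi.sub_apply, Pi.mul_apply, Pi.pow_apply]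
  generalize k 0 = p at *
  generalize m 0 = q at *
  obtain ⟨ζ, w⟩ := p
  obtain ⟨v₁, v₂⟩ := v
  obtain ⟨u₁, u₂⟩ := q
  obtain ⟨n₁, n₂⟩ := n
  simp only at hw
  simp [dualFormDeriv, dualForm, inner, killing, killingDeriv, pow_two]
  field_simp
  ring

theorem contDiffAt_dualForm (a b c : ℂ) {q : (ℂ × ℝ) × (ℂ × ℝ)} (h : q.1 ∈ space) :
    ContDiffAt ℝ ((⊤ : ℕ∞) : WithTop ℕ∞)
      (fun q : (ℂ × ℝ) × (ℂ × ℝ) => dualForm a b c q.1 q.2) q := by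
  have hw : q.1.2 ^ 2 ≠ 0 := pow_ne_zero 2 (ne_of_gt h)
  have hre := Complex.reCLM.contDiff (n := ((⊤ : ℕ∞) : WithTop ℕ∞))
  have hof := Complex.ofRealCLM.contDiff (n := ((⊤ : ℕ∞) : WithTop ℕ∞))
  have hcj := Complex.conjCLE.contDiff (n := ((⊤ : ℕ∞) : WithTop ℕ∞))
  have h11 : ContDiff ℝ ((⊤ : ℕ∞) : WithTop ℕ∞) (fun q : (ℂ × ℝ) × (ℂ × ℝ) => q.1.1) := by fun_prop
  have h12 : ContDiff ℝ ((⊤ : ℕ∞) : WithTop ℕ∞) (fun q : (ℂ × ℝ) × (ℂ × ℝ) => q.1.2) := by fun_prop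
  have h21 : ContDiff ℝ ((⊤ : ℕ∞) : WithTop ℕ∞) (fun q : (ℂ × ℝ) × (ℂ × ℝ) => q.2.1) := by fun_prop
  have h22 : ContDiff ℝ ((⊤ : ℕ∞) : WithTop ℕ∞) (fun q : (ℂ × ℝ) × (ℂ × ℝ) => q.2.2) := by fun_prop
  have hZ1 := (((contDiff_const (c := I * b)).add ((contDiff_const (c := 2 * (I * a))).mul h11)).sub
    ((contDiff_const (c := I * c)).mul (h11.pow 2))).add
    ((contDiff_const (c := conj (I * c))).mul ((hof.comp h12).pow 2))
  have hZ2 := ((contDiff_const (c := (2 : ℝ))).mul h12).mul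
    (hre.comp ((contDiff_const (c := I * a)).sub ((contDiff_const (c := I * c)).mul h11)))
  exact ((hre.comp ((hcj.comp h21).mul hZ1)).add (h22.mul hZ2)).contDiffAt.div
    (h12.pow 2).contDiffAt hw

end H3

/-! ### Green's theorem in polar coordinates. -/

open MeasureTheory in
/-- Green's theorem on the unit disc. -/
theorem integral_ball_curl {f₀ f₁ : ℂ → ℝ} {D₀ D₁ : ℂ → ℂ →L[ℝ] ℝ}
    (h₀ : ∀ z ∈ Metric.closedBall (0 : ℂ) 1, HasFDerivAt f₀ (D₀ z) z)
    (h₁ : ∀ z ∈ Metric.closedBall (0 : ℂ) 1, HasFDerivAt f₁ (D₁ z) z)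
    (c₀ : ContinuousOn D₀ (Metric.closedBall (0 : ℂ) 1))
    (c₁ : ContinuousOn D₁ (Metric.closedBall (0 : ℂ) 1)) :
    ∫ z in Metric.ball (0 : ℂ) 1, (D₁ z 1 - D₀ z I) =
      ∫ t in -Real.pi..Real.pi,
        (f₁ (Real.cos t + Real.sin t * I) * Real.cos t
          - f₀ (Real.cos t + Real.sin t * I) * Real.sin t) := by
  have hpi : -Real.pi ≤ Real.pi := by linarith [Real.pi_pos]
  set e : ℝ × ℝ → ℂ := fun p => p.1 * (Real.cos p.2 + Real.sin p.2 * I) with he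
  have hcs : ∀ t : ℝ, ‖((Real.cos t : ℂ) + Real.sin t * I)‖ = 1 := by
    intro t
    have := Complex.norm_exp_ofReal_mul_I t
    rwa [Complex.exp_mul_I, ← Complex.ofReal_cos, ← Complex.ofReal_sin] at this
  have hen : ∀ p, ‖e p‖ = |p.1| := by
    intro p
    simp only [he, norm_mul, hcs, mul_one, Complex.norm_real, Real.norm_eq_abs]
  have hec : Continuous e := by
    simp only [he]
    fun_prop
  set R : Set (ℝ × ℝ) := Set.Icc 0 1 ×ˢ Set.Icc (-Real.pi) Real.pi with hR
  have hRe : Set.MapsTo e R (Metric.closedBall 0 1) := by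
    intro p hp
    rw [mem_closedBall_zero_iff, hen, abs_of_nonneg hp.1.1]
    exact hp.1.2
  have cf₀ : ContinuousOn f₀ (Metric.closedBall (0 : ℂ) 1) := fun z hz =>
    (h₀ z hz).continuousAt.continuousWithinAt
  have cf₁ : ContinuousOn f₁ (Metric.closedBall (0 : ℂ) 1) := fun z hz =>
    (h₁ z hz).continuousAt.continuousWithinAt
  set curl : ℂ → ℝ := fun z => D₁ z 1 - D₀ z I with hcurl
  have ccurl : ContinuousOn curl (Metric.closedBall (0 : ℂ) 1) :=
    (c₁.clm_apply continuousOn_const).sub (c₀.clm_apply continuousOn_const)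
  have cF : ContinuousOn (fun p : ℝ × ℝ => p.1 • curl (e p)) R :=
    continuousOn_fst.smul (ccurl.comp hec.continuousOn hRe)
  have hint : IntegrableOn (fun p : ℝ × ℝ => p.1 • curl (e p)) R :=
    cF.integrableOn_compact (isCompact_Icc.prod isCompact_Icc)
  have step1 : ∫ z in Metric.ball (0 : ℂ) 1, curl z =
      ∫ x in (0 : ℝ)..1, ∫ y in -Real.pi..Real.pi, x • curl (e (x, y)) := by
    rw [← integral_indicator measurableSet_ball, ← Complex.integral_comp_polarCoord_symm]
    have hset : ∀ p ∈ polarCoord.target,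
        p.1 • (Metric.ball (0 : ℂ) 1).indicator curl (Complex.polarCoord.symm p) =
        (Set.Ioo (0 : ℝ) 1 ×ˢ Set.Ioo (-Real.pi) Real.pi).indicator
          (fun p : ℝ × ℝ => p.1 • curl (e p)) p := by
      intro p hp
      rw [Complex.polarCoord_symm_apply]
      have hp1 : 0 < p.1 := hp.1
      by_cases h : p.1 < 1
      · rw [Set.indicator_of_mem, Set.indicator_of_mem]
        · exact ⟨⟨hp1, h⟩, hp.2⟩
        · rw [mem_ball_zero_iff]
          exact (hen p).trans_lt (by rwa [abs_of_pos hp1])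
      · rw [Set.indicator_of_notMem, Set.indicator_of_notMem, smul_zero]
        · exact fun h' => h h'.1.2
        · rw [mem_ball_zero_iff]
          intro h'
          have := (hen p).symm.trans_lt h'
          rw [abs_of_pos hp1] at this
          exact h this
    rw [setIntegral_congr_fun (polarCoord.open_target.measurableSet) hset,
      setIntegral_indicator (measurableSet_Ioo.prod measurableSet_Ioo)]
    have : polarCoord.target ∩ Set.Ioo (0 : ℝ) 1 ×ˢ Set.Ioo (-Real.pi) Real.pi =
        Set.Ioo (0 : ℝ) 1 ×ˢ Set.Ioo (-Real.pi) Real.pi := by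
      apply Set.inter_eq_right.mpr
      exact Set.prod_mono (fun x hx => hx.1) le_rfl
    rw [this, Measure.volume_eq_prod, setIntegral_prod]
    · simp only [intervalIntegral.integral_of_le hpi, intervalIntegral.integral_of_le zero_le_one,
        integral_Ioc_eq_integral_Ioo]
    · exact hint.mono_set (Set.prod_mono Set.Ioo_subset_Icc_self Set.Ioo_subset_Icc_self)
  rw [step1]
  -- Pulled back to polar coordinates, the form $f_0\,dx+f_1\,dy$ has `f` as angular coefficient and
  -- `-g` as radial coefficient, so the divergence of `(f, g)` is $r$ times the curl. The edge $r=0$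
  -- contributes nothing because of the factor $r$, and the edges at angles $\pm\pi$ cancel.
  set f : ℝ × ℝ → ℝ := fun p => p.1 * (f₁ (e p) * Real.cos p.2 - f₀ (e p) * Real.sin p.2) with hf
  set g : ℝ × ℝ → ℝ := fun p => -(f₀ (e p) * Real.cos p.2 + f₁ (e p) * Real.sin p.2) with hg
  have cf : ContinuousOn f R := by
    have a := cf₀.comp hec.continuousOn hRe
    have b := cf₁.comp hec.continuousOn hRe
    exact continuousOn_fst.mul ((b.mul (by fun_prop)).sub (a.mul (by fun_prop)))
  have cg : ContinuousOn g R := by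
    have a := cf₀.comp hec.continuousOn hRe
    have b := cf₁.comp hec.continuousOn hRe
    exact ((a.mul (by fun_prop)).add (b.mul (by fun_prop))).neg
  have hed : ∀ p : ℝ × ℝ, HasFDerivAt e
      (((p.1 : ℂ) • (((-Real.sin p.2 : ℝ) : ℂ) + (Real.cos p.2 : ℝ) * I) •
          (Complex.ofRealCLM.comp (ContinuousLinearMap.snd ℝ ℝ ℝ)))
        + ((Real.cos p.2 : ℂ) + Real.sin p.2 * I) •
          (Complex.ofRealCLM.comp (ContinuousLinearMap.fst ℝ ℝ ℝ))) p := by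
    intro p
    have hof : HasFDerivAt (fun p : ℝ × ℝ => (p.1 : ℂ))
        (Complex.ofRealCLM.comp (ContinuousLinearMap.fst ℝ ℝ ℝ)) p :=
      (Complex.ofRealCLM.comp (ContinuousLinearMap.fst ℝ ℝ ℝ)).hasFDerivAt
    have hth : HasDerivAt (fun t : ℝ => (Real.cos t : ℂ) + Real.sin t * I)
        (((-Real.sin p.2 : ℝ) : ℂ) + (Real.cos p.2 : ℝ) * I) p.2 :=
      (Real.hasDerivAt_cos p.2).ofReal_comp.add ((Real.hasDerivAt_sin p.2).ofReal_comp.mul_const I)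
    have h2 := hth.hasFDerivAt.comp p
      (hasFDerivAt_snd (𝕜 := ℝ) (E := ℝ) (F := ℝ) (p := p))
    refine (hof.mul h2).congr_fderiv ?_
    ext <;> simp
  have hcos : ∀ p : ℝ × ℝ, HasFDerivAt (fun p : ℝ × ℝ => Real.cos p.2)
      (-Real.sin p.2 • ContinuousLinearMap.snd ℝ ℝ ℝ) p := fun p =>
    hasFDerivAt_snd.cos
  have hsin : ∀ p : ℝ × ℝ, HasFDerivAt (fun p : ℝ × ℝ => Real.sin p.2)
      (Real.cos p.2 • ContinuousLinearMap.snd ℝ ℝ ℝ) p := fun p =>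
    hasFDerivAt_snd.sin
  have hf' : ∀ p ∈ R, HasFDerivAt f (fderiv ℝ f p) p ∧ HasFDerivAt g (fderiv ℝ g p) p ∧
      fderiv ℝ f p (1, 0) + fderiv ℝ g p (0, 1) = p.1 • curl (e p) := by
    intro p hp
    have a := (h₀ _ (hRe hp)).comp p (hed p)
    have b := (h₁ _ (hRe hp)).comp p (hed p)
    have F := hasFDerivAt_fst.mul ((b.mul (hcos p)).sub (a.mul (hsin p)))
    have G := ((a.mul (hcos p)).add (b.mul (hsin p))).neg
    refine ⟨F.differentiableAt.hasFDerivAt, G.differentiableAt.hasFDerivAt, ?_⟩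
    have eF : fderiv ℝ f p = _ := F.fderiv
    have eG : fderiv ℝ g p = _ := G.fderiv
    rw [eF, eG]
    have lin : ∀ (L : ℂ →L[ℝ] ℝ) (x y : ℝ), L ((x : ℂ) + y * I) = x * L 1 + y * L I := by
      intro L x y
      have : (x : ℂ) + y * I = x • (1 : ℂ) + y • I := by simp
      rw [this, map_add, map_smul, map_smul]; rfl
    have lin2 : ∀ (L : ℂ →L[ℝ] ℝ) (r x y : ℝ), L ((r : ℂ) * ((x : ℂ) + y * I)) =
        r * (x * L 1 + y * L I) := by
      intro L r x y
      have : (r : ℂ) * ((x : ℂ) + y * I) = r • ((x : ℂ) + y * I) :=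
        (Complex.real_smul ..).symm
      rw [this, map_smul, lin]; rfl
    simp only [add_apply, sub_apply,
      neg_apply, smul_apply,
      ContinuousLinearMap.comp_apply, ContinuousLinearMap.coe_fst', ContinuousLinearMap.coe_snd',
      Complex.ofRealCLM_apply, smul_eq_mul, Complex.ofReal_zero, Complex.ofReal_one, mul_one,
      mul_zero, zero_add, add_zero, lin, lin2, Function.comp_apply, hcurl, Pi.sub_apply, Pi.mul_apply]
    have := Real.sin_sq_add_cos_sq p.2
    generalize (D₀ (e p)) 1 = d01
    generalize (D₀ (e p)) I = d0I
    generalize (D₁ (e p)) 1 = d11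
    generalize (D₁ (e p)) I = d1I
    linear_combination p.1 * (d11 - d0I) * this
  have huI : (Set.uIcc (0 : ℝ) 1 ×ˢ Set.uIcc (-Real.pi) Real.pi) = R := by
    rw [Set.uIcc_of_le zero_le_one, Set.uIcc_of_le hpi]
  have hIoo : ∀ p ∈ Set.Ioo (min (0 : ℝ) 1) (max 0 1) ×ˢ
      Set.Ioo (min (-Real.pi) Real.pi) (max (-Real.pi) Real.pi), p ∈ R := by
    rw [min_eq_left zero_le_one, max_eq_right zero_le_one, min_eq_left hpi, max_eq_right hpi]
    exact fun p hp => Set.prod_mono Set.Ioo_subset_Icc_self Set.Ioo_subset_Icc_self hp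
  have key := integral2_divergence_prod_of_hasFDerivAt f g (fderiv ℝ f) (fderiv ℝ g)
    0 (-Real.pi) 1 Real.pi (by rwa [huI]) (by rwa [huI])
    (fun p hp => (hf' p (hIoo p hp)).1) (fun p hp => (hf' p (hIoo p hp)).2.1)
    (by
      rw [huI]
      exact hint.congr_fun (fun p hp => ((hf' p hp).2.2).symm)
        (measurableSet_Icc.prod measurableSet_Icc))
  have hlhs : ∫ x in (0 : ℝ)..1, ∫ y in -Real.pi..Real.pi, x • curl (e (x, y)) =
      ∫ x in (0 : ℝ)..1, ∫ y in -Real.pi..Real.pi,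
        fderiv ℝ f (x, y) (1, 0) + fderiv ℝ g (x, y) (0, 1) := by
    refine intervalIntegral.integral_congr fun x hx => intervalIntegral.integral_congr fun y hy => ?_
    rw [Set.uIcc_of_le zero_le_one] at hx
    rw [Set.uIcc_of_le hpi] at hy
    exact ((hf' (x, y) ⟨hx, hy⟩).2.2).symm
  rw [hlhs, key]
  simp [hf, hg, he]

/-! ### Smoothness of the immersion and Stokes' theorem on spanning discs. -/

namespace BryantEnd

variable (E : BryantEnd)

/-- The punctured disc on which the end is parametrized. -/
def disc : Set ℂ := Metric.ball (0 : ℂ) E.r \ {0}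

theorem isOpen_disc : IsOpen E.disc := Metric.isOpen_ball.sdiff isClosed_singleton

theorem denom_pos {z : ℂ} (hz : z ∈ E.disc) : 0 < ‖E.A z‖ ^ 2 + ‖E.B z‖ ^ 2 := by
  by_cases h : E.A z = 0
  · have : E.B z ≠ 0 := by
      intro h'
      have := E.det_eq z hz
      rw [h, h'] at this
      simp at this
    have := norm_pos_iff.mpr this
    positivity
  · have := norm_pos_iff.mpr h
    positivity

theorem X_mem_space {z : ℂ} (hz : z ∈ E.disc) : E.X z ∈ H3.space :=
  one_div_pos.mpr (E.denom_pos hz)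

theorem contDiffAt_of_differentiableOn {f : ℂ → ℂ} (hf : DifferentiableOn ℂ f E.disc) {z : ℂ}
    (hz : z ∈ E.disc) : ContDiffAt ℝ ((⊤ : ℕ∞) : WithTop ℕ∞) f z :=
  ((hf.contDiffOn E.isOpen_disc).contDiffAt (E.isOpen_disc.mem_nhds hz)).restrict_scalars ℝ

theorem contDiffAt_X {z : ℂ} (hz : z ∈ E.disc) :
    ContDiffAt ℝ ((⊤ : ℕ∞) : WithTop ℕ∞) E.X z := by
  have hA := E.contDiffAt_of_differentiableOn E.holA hz
  have hB := E.contDiffAt_of_differentiableOn E.holB hz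
  have hC := E.contDiffAt_of_differentiableOn E.holC hz
  have hD := E.contDiffAt_of_differentiableOn E.holD hz
  have hcj := Complex.conjCLE.contDiff (n := ((⊤ : ℕ∞) : WithTop ℕ∞))
  have hof := Complex.ofRealCLM.contDiff (n := ((⊤ : ℕ∞) : WithTop ℕ∞))
  have hn := (hA.norm_sq ℝ).add (hB.norm_sq ℝ)
  have h0 := (E.denom_pos hz).ne'
  have hnc : ContDiffAt ℝ ((⊤ : ℕ∞) : WithTop ℕ∞)
      (fun z => ((‖E.A z‖ ^ 2 + ‖E.B z‖ ^ 2 : ℝ) : ℂ)) z := hof.contDiffAt.comp z hn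
  refine ContDiffAt.prodMk ?_ (contDiffAt_const.div hn h0)
  simp only [div_eq_mul_inv]
  exact (((hcj.contDiffAt.comp z hA).mul hC).add ((hcj.contDiffAt.comp z hB).mul hD)).mul
    (hnc.inv (by exact_mod_cast h0))

theorem differentiableAt_X {z : ℂ} (hz : z ∈ E.disc) : DifferentiableAt ℝ E.X z :=
  (E.contDiffAt_X hz).differentiableAt (by simp)

end BryantEnd

namespace H3

theorem dualForm_add (a b c : ℂ) (p v u : ℂ × ℝ) :
    dualForm a b c p (v + u) = dualForm a b c p v + dualForm a b c p u := by
  simp [dualForm, inner]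
  ring

theorem dualForm_smul (a b c : ℂ) (p v : ℂ × ℝ) (t : ℝ) :
    dualForm a b c p (t • v) = t * dualForm a b c p v := by
  simp [dualForm, inner]
  ring

end H3

namespace BryantEnd

/-- Stokes' theorem for the flux of a Killing field through a disc. -/
theorem discIntegral_eq_integral_boundary {K : ℂ → ℂ × ℝ}
    (hK : ContDiff ℝ ((⊤ : ℕ∞) : WithTop ℕ∞) K)
    (hmem : ∀ z ∈ Metric.closedBall (0 : ℂ) 1, K z ∈ H3.space) {Y : ℂ × ℝ → ℂ × ℝ} {a b c : ℂ}
    (hY : ∀ p ∈ H3.space, Y p = H3.killing a b c p) :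
    2 * discIntegral Y K = ∫ t in -Real.pi..Real.pi,
      H3.dualForm a b c (K (Real.cos t + Real.sin t * I))
        (fderiv ℝ K (Real.cos t + Real.sin t * I)
          (((-Real.sin t : ℝ) : ℂ) + (Real.cos t : ℝ) * I)) := by
  have hK' : ContDiff ℝ ((⊤ : ℕ∞) : WithTop ℕ∞) (fderiv ℝ K) := hK.fderiv_right (by simp)
  have hf : ∀ e : ℂ, ∀ z ∈ Metric.closedBall (0 : ℂ) 1, ContDiffAt ℝ ((⊤ : ℕ∞) : WithTop ℕ∞)
      (fun z => H3.dualForm a b c (K z) (fderiv ℝ K z e)) z := by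
    intro e z hz
    exact (H3.contDiffAt_dualForm a b c (q := (K z, fderiv ℝ K z e)) (hmem z hz)).comp z
      (hK.contDiffAt.prodMk (hK'.contDiffAt.clm_apply contDiffAt_const))
  have hD : ∀ e : ℂ, ∀ z ∈ Metric.closedBall (0 : ℂ) 1,
      HasFDerivAt (fun z => H3.dualForm a b c (K z) (fderiv ℝ K z e))
        (fderiv ℝ (fun z => H3.dualForm a b c (K z) (fderiv ℝ K z e)) z) z := fun e z hz =>
    ((hf e z hz).differentiableAt (by simp)).hasFDerivAt
  have hcont : ∀ e : ℂ, ContinuousOn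
      (fderiv ℝ (fun z => H3.dualForm a b c (K z) (fderiv ℝ K z e)))
      (Metric.closedBall (0 : ℂ) 1) := fun e z hz =>
    ((hf e z hz).fderiv_right (m := 0) (by simp)).continuousAt.continuousWithinAt
  have hval : ∀ e v : ℂ, ∀ z ∈ Metric.closedBall (0 : ℂ) 1,
      fderiv ℝ (fun z => H3.dualForm a b c (K z) (fderiv ℝ K z e)) z v =
        H3.dualFormDeriv a b c (K z) (fderiv ℝ K z v) (fderiv ℝ K z e)
          + H3.dualForm a b c (K z) (fderiv ℝ (fderiv ℝ K) z v e) := by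
    intro e v z hz
    have hline : HasDerivAt (fun s : ℝ => z + s • v) v 0 := by
      simpa using ((hasDerivAt_id (0 : ℝ)).smul_const v).const_add z
    have hz0 : z + (0 : ℝ) • v = z := by simp
    have hk : HasDerivAt (fun s : ℝ => K (z + s • v)) (fderiv ℝ K z v) 0 := by
      refine HasFDerivAt.comp_hasDerivAt (l := K) (f := fun s : ℝ => z + s • v) 0 ?_ hline
      rw [hz0]
      exact (hK.differentiable (by simp) z).hasFDerivAt
    have hm : HasDerivAt (fun s : ℝ => fderiv ℝ K (z + s • v) e)
        (fderiv ℝ (fderiv ℝ K) z v e) 0 := by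
      have h1 : HasDerivAt (fun s : ℝ => fderiv ℝ K (z + s • v)) (fderiv ℝ (fderiv ℝ K) z v) 0 := by
        refine HasFDerivAt.comp_hasDerivAt (l := fderiv ℝ K) (f := fun s : ℝ => z + s • v) 0 ?_ hline
        rw [hz0]
        exact (hK'.differentiable (by simp) z).hasFDerivAt
      simpa using h1.clm_apply (hasDerivAt_const (0 : ℝ) e)
    have h2 := H3.hasDerivAt_dualForm a b c hk hm (by rw [hz0]; exact hmem z hz)
    have h3 : HasDerivAt (fun s : ℝ => H3.dualForm a b c (K (z + s • v)) (fderiv ℝ K (z + s • v) e))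
        (fderiv ℝ (fun z => H3.dualForm a b c (K z) (fderiv ℝ K z e)) z v) 0 := by
      refine HasFDerivAt.comp_hasDerivAt
        (l := fun z => H3.dualForm a b c (K z) (fderiv ℝ K z e))
        (f := fun s : ℝ => z + s • v) 0 ?_ hline
      rw [hz0]
      exact hD e z hz
    simpa using h3.unique h2
  have hcurl : ∀ z ∈ Metric.closedBall (0 : ℂ) 1,
      2 * H3.vol (K z) (fderiv ℝ K z 1) (fderiv ℝ K z I) (Y (K z)) =
      fderiv ℝ (fun z => H3.dualForm a b c (K z) (fderiv ℝ K z I)) z 1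
        - fderiv ℝ (fun z => H3.dualForm a b c (K z) (fderiv ℝ K z 1)) z I := by
    intro z hz
    -- The second derivatives of `K` cancel in the curl by symmetry, leaving only the
    -- antisymmetrized derivative of the dual form.
    have hsymm : fderiv ℝ (fderiv ℝ K) z 1 I = fderiv ℝ (fderiv ℝ K) z I 1 :=
      (hK.contDiffAt.isSymmSndFDerivAt
        (by rw [minSmoothness_of_isRCLikeNormedField]; exact WithTop.coe_le_coe.mpr le_top)) 1 I
    rw [hval I 1 z hz, hval 1 I z hz, hsymm, hY _ (hmem z hz),
      ← H3.dualFormDeriv_antisymm a b c (hmem z hz)]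
    ring
  unfold discIntegral
  rw [← MeasureTheory.integral_const_mul]
  rw [MeasureTheory.setIntegral_congr_fun measurableSet_ball
    (fun z hz => hcurl z (Metric.ball_subset_closedBall hz))]
  rw [integral_ball_curl (hD 1) (hD I) (hcont 1) (hcont I)]
  refine intervalIntegral.integral_congr fun t _ => ?_
  have : ((-Real.sin t : ℝ) : ℂ) + (Real.cos t : ℝ) * I = (-Real.sin t) • (1 : ℂ) + Real.cos t • I := by
    simp
  simp only [this, map_add, map_smul, H3.dualForm_add, H3.dualForm_smul]
  ring

variable (E : BryantEnd)

/-- The minus sign arises because the boundary of `K` runs along $X\circ\gamma$ backwards.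
Periodicity then moves the interval from $[-\pi,\pi]$ to $[0,2\pi]$. -/
theorem two_mul_discIntegral {γ : ℝ → ℂ} {K : ℂ → ℂ × ℝ} (hγ : E.IsGenerator γ)
    (hK : E.IsSpanningDisc γ K) {Y : ℂ × ℝ → ℂ × ℝ} {a b c : ℂ}
    (hY : ∀ p ∈ H3.space, Y p = H3.killing a b c p) :
    2 * discIntegral Y K = -∫ τ in (0 : ℝ)..2 * Real.pi,
      H3.dualForm a b c (E.X (γ τ)) (fderiv ℝ E.X (γ τ) (deriv γ τ)) := by
  rw [discIntegral_eq_integral_boundary hK.smooth hK.mem hY]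
  have hb : ∀ t : ℝ, K (Real.cos t + Real.sin t * I) = E.X (γ (-t)) := by
    intro t
    rw [← hK.boundary (-t)]
    congr 1
    push_cast
    rw [neg_mul, neg_neg, Complex.exp_mul_I]
  have hd : ∀ t : ℝ, fderiv ℝ K (Real.cos t + Real.sin t * I)
      (((-Real.sin t : ℝ) : ℂ) + (Real.cos t : ℝ) * I) =
      -fderiv ℝ E.X (γ (-t)) (deriv γ (-t)) := by
    intro t
    have hth : HasDerivAt (fun t : ℝ => (Real.cos t : ℂ) + Real.sin t * I)
        (((-Real.sin t : ℝ) : ℂ) + (Real.cos t : ℝ) * I) t :=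
      (Real.hasDerivAt_cos t).ofReal_comp.add ((Real.hasDerivAt_sin t).ofReal_comp.mul_const I)
    have h1 := ((hK.smooth.differentiable (by simp) _).hasFDerivAt).comp_hasDerivAt t hth
    have hg : HasDerivAt (fun t : ℝ => γ (-t)) (-deriv γ (-t)) t := by
      have := ((hγ.smooth.differentiable (by simp) (-t)).hasDerivAt).scomp t (hasDerivAt_neg t)
      rwa [neg_one_smul] at this
    have h2 := ((E.differentiableAt_X (hγ.mem (-t))).hasFDerivAt).comp_hasDerivAt t hg
    rw [← map_neg]
    refine h1.unique (h2.congr_of_eventuallyEq ?_)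
    exact Eventually.of_forall hb
  have e1 : ∀ t : ℝ, H3.dualForm a b c (K (Real.cos t + Real.sin t * I))
        (fderiv ℝ K (Real.cos t + Real.sin t * I)
          (((-Real.sin t : ℝ) : ℂ) + (Real.cos t : ℝ) * I)) =
      -(fun τ => H3.dualForm a b c (E.X (γ τ)) (fderiv ℝ E.X (γ τ) (deriv γ τ))) (-t) := by
    intro t
    rw [hb, hd, ← neg_one_smul ℝ (fderiv ℝ E.X _ _), H3.dualForm_smul, neg_one_mul]
  simp only [e1, intervalIntegral.integral_neg]
  rw [intervalIntegral.integral_comp_neg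
    (fun τ => H3.dualForm a b c (E.X (γ τ)) (fderiv ℝ E.X (γ τ) (deriv γ τ))), neg_neg]
  have hper : Function.Periodic
      (fun τ => H3.dualForm a b c (E.X (γ τ)) (fderiv ℝ E.X (γ τ) (deriv γ τ))) (2 * Real.pi) := by
    intro τ
    have h' : deriv γ (τ + 2 * Real.pi) = deriv γ τ := by
      rw [← deriv_comp_add_const]
      congr 1
      exact funext hγ.periodic
    simp only [hγ.periodic τ, h']
  have := hper.intervalIntegral_add_eq (-Real.pi) 0
  rw [zero_add, show -Real.pi + 2 * Real.pi = Real.pi by ring] at this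
  rw [this]

end BryantEnd

/-! ### Conformality and the holomorphic flux form. -/

namespace H3

/-- The quantity $p\bar q+s^2$ is, up to a factor, the coefficient of $v^2$ in the squared length of
the vector. This is the only part that changes sign when $v$ becomes $iv$, so its vanishing is
conformality. -/
theorem inner_I_smul_eq {p q s : ℂ} (h : p * conj q + s ^ 2 = 0) (x : ℂ × ℝ) (v : ℂ) :
    inner x (p * (I * v) + q * conj (I * v), 2 * (s * (I * v)).re)
        (p * (I * v) + q * conj (I * v), 2 * (s * (I * v)).re) =
      inner x (p * v + q * conj v, 2 * (s * v).re) (p * v + q * conj v, 2 * (s * v).re) := by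
  unfold inner
  congr 1
  have hv : ((p * conj q + s ^ 2) * v ^ 2).re = 0 := by rw [h]; simp
  simp [pow_two] at hv ⊢
  linear_combination -4 * hv

/-- The conormal term and the dual form carry opposite antilinear parts in `v`, so their sum is the
imaginary part of a complex-linear expression. This cancellation makes the flux integrand
holomorphic. -/
theorem inner_add_dualForm (a b c p q s v : ℂ) {x : ℂ × ℝ} (hx : x ∈ space) :
    inner x (p * (I * v) + q * conj (I * v), 2 * (s * (I * v)).re) (killing a b c x)
        + dualForm a b c x (p * v + q * conj v, 2 * (s * v).re) =
      -2 * (((conj q * (b + 2 * a * x.1 - c * x.1 ^ 2) + c * p * (x.2 : ℂ) ^ 2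
        + 2 * x.2 * s * (a - c * x.1)) * v).im) / x.2 ^ 2 := by
  have hw : x.2 ≠ 0 := ne_of_gt hx
  obtain ⟨ζ, w⟩ := x
  simp only at hw
  simp [inner, dualForm, killing, pow_two]
  field_simp
  ring

theorem inner_self_eq_zero {x v : ℂ × ℝ} (hx : x ∈ space) (h : inner x v v = 0) : v = 0 := by
  have hw : 0 < x.2 := hx
  have h1 := (div_eq_zero_iff.mp h).resolve_right (by positivity)
  have h2 : (conj v.1 * v.1).re = Complex.normSq v.1 := by
    rw [← Complex.normSq_eq_conj_mul_self, Complex.ofReal_re]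
  rw [h2] at h1
  have h3 := Complex.normSq_nonneg v.1
  have h4 := mul_self_nonneg v.2
  refine Prod.ext (Complex.normSq_eq_zero.mp (by linarith)) (mul_self_eq_zero.mp (by linarith))

theorem inner_self_nonneg (x v : ℂ × ℝ) : 0 ≤ inner x v v := by
  have h2 : (conj v.1 * v.1).re = Complex.normSq v.1 := by
    rw [← Complex.normSq_eq_conj_mul_self, Complex.ofReal_re]
  have h3 := Complex.normSq_nonneg v.1
  have h4 := mul_self_nonneg v.2
  unfold inner
  rw [h2]
  positivity

theorem inner_smul_left (x v u : ℂ × ℝ) (t : ℝ) : inner x (t • v) u = t * inner x v u := by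
  simp [inner]
  ring

end H3

namespace BryantEnd

variable (E : BryantEnd)

theorem hasDerivAt_of_differentiableOn {f : ℂ → ℂ} (hf : DifferentiableOn ℂ f E.disc) {z : ℂ}
    (hz : z ∈ E.disc) : HasDerivAt f (deriv f z) z :=
  (hf.differentiableAt (E.isOpen_disc.mem_nhds hz)).hasDerivAt

theorem deriv_det {z : ℂ} (hz : z ∈ E.disc) :
    deriv E.A z * E.D z + E.A z * deriv E.D z - deriv E.B z * E.C z - E.B z * deriv E.C z = 0 := by
  have h := ((E.hasDerivAt_of_differentiableOn E.holA hz).mul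
    (E.hasDerivAt_of_differentiableOn E.holD hz)).sub
    ((E.hasDerivAt_of_differentiableOn E.holB hz).mul
      (E.hasDerivAt_of_differentiableOn E.holC hz))
  have h' : HasDerivAt (E.A * E.D - E.B * E.C) 0 z :=
    (hasDerivAt_const z (1 : ℂ)).congr_of_eventuallyEq
      (eventually_of_mem (E.isOpen_disc.mem_nhds hz) E.det_eq)
  linear_combination h.unique h'

/-- The derivative `∂ζ/∂z` of the horizontal component of the immersion. -/
def Xz (z : ℂ) : ℂ :=
  ((conj (E.A z) * deriv E.C z + conj (E.B z) * deriv E.D z) * (‖E.A z‖ ^ 2 + ‖E.B z‖ ^ 2 : ℝ)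
    - (conj (E.A z) * E.C z + conj (E.B z) * E.D z) *
      (conj (E.A z) * deriv E.A z + conj (E.B z) * deriv E.B z))
    / ((‖E.A z‖ ^ 2 + ‖E.B z‖ ^ 2 : ℝ) : ℂ) ^ 2

/-- The derivative `∂ζ/∂z̄` of the horizontal component of the immersion. -/
def Xzbar (z : ℂ) : ℂ :=
  -conj (deriv E.A z * E.B z - E.A z * deriv E.B z) / ((‖E.A z‖ ^ 2 + ‖E.B z‖ ^ 2 : ℝ) : ℂ) ^ 2

/-- The derivative `∂w/∂z` of the vertical component of the immersion. -/
def Xw (z : ℂ) : ℂ :=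
  -(conj (E.A z) * deriv E.A z + conj (E.B z) * deriv E.B z)
    / ((‖E.A z‖ ^ 2 + ‖E.B z‖ ^ 2 : ℝ) : ℂ) ^ 2

theorem fderiv_X {z : ℂ} (hz : z ∈ E.disc) (v : ℂ) :
    fderiv ℝ E.X z v = (E.Xz z * v + E.Xzbar z * conj v, 2 * (E.Xw z * v).re) := by
  have hline : HasDerivAt (fun s : ℝ => z + s • v) v 0 := by
    simpa using ((hasDerivAt_id (0 : ℝ)).smul_const v).const_add z
  have hz0 : z + (0 : ℝ) • v = z := by simp
  have hX : HasDerivAt (fun s : ℝ => E.X (z + s • v)) (fderiv ℝ E.X z v) 0 := by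
    refine HasFDerivAt.comp_hasDerivAt (l := E.X) (f := fun s : ℝ => z + s • v) 0 ?_ hline
    rw [hz0]
    exact (E.differentiableAt_X hz).hasFDerivAt
  refine hX.unique ?_
  have hf : ∀ {f : ℂ → ℂ}, DifferentiableOn ℂ f E.disc →
      HasDerivAt (fun s : ℝ => f (z + s • v)) (deriv f z * v) 0 := by
    intro f h
    have h1 := E.hasDerivAt_of_differentiableOn h hz
    rw [← hz0] at h1
    have := HasDerivAt.comp (0 : ℝ) h1 hline
    rwa [hz0] at this
  have hc : ∀ {f : ℝ → ℂ} {f' : ℂ}, HasDerivAt f f' 0 →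
      HasDerivAt (fun t => conj (f t)) (conj f') 0 := fun hf => hf.star
  have hn : ∀ {f : ℝ → ℂ} {f' : ℂ}, HasDerivAt f f' 0 →
      HasDerivAt (fun t => ‖f t‖ ^ 2) (2 * (conj (f 0) * f').re) 0 := by
    intro f f' hf
    have := hf.norm_sq
    rw [Complex.inner] at this
    simpa [mul_comm] using this
  have hA := hf E.holA
  have hB := hf E.holB
  have hC := hf E.holC
  have hD := hf E.holD
  have hN := (hn hA).add (hn hB)
  have h0 := (E.denom_pos hz).ne'
  have h0' : ((‖E.A z‖ ^ 2 + ‖E.B z‖ ^ 2 : ℝ) : ℂ) ≠ 0 := by exact_mod_cast h0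
  have hnc : ((‖E.A z‖ ^ 2 + ‖E.B z‖ ^ 2 : ℝ) : ℂ) =
      E.A z * conj (E.A z) + E.B z * conj (E.B z) := by
    rw [Complex.ofReal_add, H3.ofReal_norm_sq, H3.ofReal_norm_sq]
  refine HasDerivAt.prodMk ?_ ?_
  · refine ((((hc hA).mul hC).add ((hc hB).mul hD)).div hN.ofReal_comp ?_).congr_deriv ?_
    · simpa [hz0] using h0'
    · simp only [Pi.add_apply, Pi.mul_apply, hz0]
      have hre : ((2 * (conj (E.A z) * (deriv E.A z * v)).re
          + 2 * (conj (E.B z) * (deriv E.B z * v)).re : ℝ) : ℂ) =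
          conj (E.A z) * deriv E.A z * v + E.A z * conj (deriv E.A z * v)
          + (conj (E.B z) * deriv E.B z * v + E.B z * conj (deriv E.B z * v)) := by
        push_cast
        rw [Complex.re_eq_add_conj, Complex.re_eq_add_conj]
        simp only [map_mul, Complex.conj_conj]
        ring
      rw [hre]
      unfold Xz Xzbar
      rw [hnc] at h0' ⊢
      have hdet := E.det_eq z hz
      have hdet' := congrArg conj hdet
      simp only [map_mul, map_sub, map_one] at hdet' ⊢
      rw [div_mul_eq_mul_div, div_mul_eq_mul_div, ← add_div]
      congr 1
      generalize conj (E.A z) = α at *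
      generalize conj (E.B z) = β at *
      generalize conj (deriv E.A z) = α' at *
      generalize conj (deriv E.B z) = β' at *
      linear_combination (α * β' - α' * β) * conj v * hdet
  · refine ((hasDerivAt_const (0 : ℝ) (1 : ℝ)).div hN ?_).congr_deriv ?_
    · simpa [hz0] using h0
    · simp only [Pi.add_apply, hz0]
      unfold Xw
      rw [div_mul_eq_mul_div, ← Complex.ofReal_pow, Complex.div_ofReal_re]
      rw [zero_mul, zero_sub, one_mul, mul_div_assoc']
      congr 1
      simp
      ring

/-- After the common denominator is removed, the $(2,0)$ part of the pulled-back metric is a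
combination of $\det F=1$, its derivative, and $\det F'=0$. -/
theorem conformal {z : ℂ} (hz : z ∈ E.disc) : E.Xz z * conj (E.Xzbar z) + E.Xw z ^ 2 = 0 := by
  have h0 := (E.denom_pos hz).ne'
  have h0' : ((‖E.A z‖ ^ 2 + ‖E.B z‖ ^ 2 : ℝ) : ℂ) ≠ 0 := by exact_mod_cast h0
  have hnc : ((‖E.A z‖ ^ 2 + ‖E.B z‖ ^ 2 : ℝ) : ℂ) =
      E.A z * conj (E.A z) + E.B z * conj (E.B z) := by
    rw [Complex.ofReal_add, H3.ofReal_norm_sq, H3.ofReal_norm_sq]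
  have h1 := E.det_eq z hz
  have h2 := E.deriv_det hz
  have h3 := E.null z hz
  unfold Xz Xzbar Xw
  simp only [map_div₀, map_neg, map_pow, Complex.conj_ofReal, Complex.conj_conj]
  rw [div_pow, div_mul_div_comm, ← pow_two, ← add_div, div_eq_zero_iff]
  left
  rw [hnc]
  generalize conj (E.A z) = α
  generalize conj (E.B z) = β
  generalize E.A z = A at *
  generalize E.B z = B at *
  generalize E.C z = C at *
  generalize E.D z = D at *
  generalize deriv E.A z = A' at *
  generalize deriv E.B z = B' at *
  generalize deriv E.C z = C' at *
  generalize deriv E.D z = D' at *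
  linear_combination (-(α ^ 2 * A' ^ 2) - β ^ 2 * B' ^ 2 - 2 * α * β * A' * B') * h1
    + (α ^ 2 * A * A' + β ^ 2 * B * B' + α * β * (A * B' + A' * B)) * h2
    - (α ^ 2 * A ^ 2 + β ^ 2 * B ^ 2 + 2 * α * β * A * B) * h3

/-- The coefficient of `dz` in the holomorphic one-form whose imaginary part is half the flux form
of the Killing field `H3.killing a b c`. -/
def fluxForm (a b c : ℂ) (z : ℂ) : ℂ :=
  b * (E.B z * deriv E.A z - E.A z * deriv E.B z)
    - 2 * a * (E.C z * deriv E.B z - E.D z * deriv E.A z)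
    - c * (E.D z * deriv E.C z - E.C z * deriv E.D z)

theorem inner_add_dualForm_eq_fluxForm (a b c : ℂ) {z : ℂ} (hz : z ∈ E.disc) (v : ℂ) :
    H3.inner (E.X z) (fderiv ℝ E.X z (I * v)) (H3.killing a b c (E.X z))
      + H3.dualForm a b c (E.X z) (fderiv ℝ E.X z v) = 2 * (E.fluxForm a b c z * v).im := by
  rw [E.fderiv_X hz, E.fderiv_X hz, H3.inner_add_dualForm _ _ _ _ _ _ _ (E.X_mem_space hz)]
  have h0 := (E.denom_pos hz).ne'
  have h0' : ((‖E.A z‖ ^ 2 + ‖E.B z‖ ^ 2 : ℝ) : ℂ) ≠ 0 := by exact_mod_cast h0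
  have hnc : ((‖E.A z‖ ^ 2 + ‖E.B z‖ ^ 2 : ℝ) : ℂ) =
      E.A z * conj (E.A z) + E.B z * conj (E.B z) := by
    rw [Complex.ofReal_add, H3.ofReal_norm_sq, H3.ofReal_norm_sq]
  have h1 := E.det_eq z hz
  have h2 := E.deriv_det hz
  have key : conj (E.Xzbar z) * (b + 2 * a * (E.X z).1 - c * (E.X z).1 ^ 2)
      + c * E.Xz z * ((E.X z).2 : ℂ) ^ 2 + 2 * (E.X z).2 * E.Xw z * (a - c * (E.X z).1) =
      -(((E.X z).2 ^ 2 : ℝ) : ℂ) * E.fluxForm a b c z := by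
    unfold Xz Xzbar Xw X fluxForm
    simp only [map_div₀, map_neg, map_pow, Complex.conj_ofReal, Complex.conj_conj,
      Complex.ofReal_pow, Complex.ofReal_div, Complex.ofReal_one]
    rw [hnc] at h0' ⊢
    generalize conj (E.A z) = α at *
    generalize conj (E.B z) = β at *
    generalize E.A z = A at *
    generalize E.B z = B at *
    generalize E.C z = C at *
    generalize E.D z = D at *
    generalize deriv E.A z = A' at *
    generalize deriv E.B z = B' at *
    generalize deriv E.C z = C' at *
    generalize deriv E.D z = D' at *
    generalize hn : A * α + B * β = n at *
    -- These two identities express the conjugate-dependent sums through entries of $dF\,F^{-1}$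
    -- times `n`. They allow all powers of `n`, and with them the dependence on the height, to
    -- cancel.
    have e1 : (A' * B - A * B') * (α * C + β * D) + (α * A' + β * B') = n * (D * A' - C * B') := by
      rw [← hn]
      linear_combination -(α * A' + β * B') * h1
    have e2 : (α * C + β * D) * (D * A' - C * B') + (α * C' + β * D') = n * (D * C' - C * D') := by
      rw [← hn]
      linear_combination (α * C + β * D) * h2 - (α * C' + β * D') * h1
    generalize α * C + β * D = S at *
    generalize α * A' + β * B' = T at *
    generalize α * C' + β * D' = U at *
    field_simp
    linear_combination (-2 * a * n + c * S) * e1 + c * n * e2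
  rw [key]
  have hw : (E.X z).2 ≠ 0 := ne_of_gt (E.X_mem_space hz)
  rw [← Complex.ofReal_neg, mul_assoc, Complex.im_ofReal_mul]
  field_simp

theorem conormal_integrand_eq (Y : ℂ × ℝ → ℂ × ℝ) {γ : ℝ → ℂ} {τ : ℝ} (hz : γ τ ∈ E.disc) :
    H3.inner (E.X (γ τ)) (E.conormal γ τ) (Y (E.X (γ τ))) *
      H3.norm (E.X (γ τ)) (fderiv ℝ E.X (γ τ) (deriv γ τ)) =
    H3.inner (E.X (γ τ)) (fderiv ℝ E.X (γ τ) (I * deriv γ τ)) (Y (E.X (γ τ))) := by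
  have hc : H3.norm (E.X (γ τ)) (fderiv ℝ E.X (γ τ) (deriv γ τ)) =
      H3.norm (E.X (γ τ)) (fderiv ℝ E.X (γ τ) (I * deriv γ τ)) := by
    unfold H3.norm
    rw [E.fderiv_X hz, E.fderiv_X hz, H3.inner_I_smul_eq (E.conformal hz)]
  unfold conormal
  rw [hc]
  simp only [H3.inner_smul_left]
  generalize fderiv ℝ E.X (γ τ) (I * deriv γ τ) = v
  -- If the norm is zero, so is the vector, and both sides vanish; otherwise the speed of the curve
  -- cancels the normalization of the conormal.
  by_cases h : H3.norm (E.X (γ τ)) v = 0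
  · have := (Real.sqrt_eq_zero (H3.inner_self_nonneg _ _)).mp h
    rw [H3.inner_self_eq_zero (E.X_mem_space hz) this]
    simp [H3.inner]
  · field_simp

end BryantEnd

/-! ### Residues, generating loops and existence of spanning discs. -/

namespace BryantEnd

variable (E : BryantEnd)

theorem ball_mem_nhds : Metric.ball (0 : ℂ) E.r ∈ 𝓝 (0 : ℂ) := Metric.ball_mem_nhds _ E.r_pos

/-- Subtracting $k'(0)/z$ from $k/z^2$ leaves $k(0)/z^2$ plus a function holomorphic on the whole
ball. Both have primitives along the loop, so only the winding number contributes. -/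
theorem integral_generator {θ k : ℂ → ℂ} (hk : DifferentiableOn ℂ k (Metric.ball 0 E.r))
    (hθ : ∀ z ∈ E.disc, θ z = k z / z ^ 2) {γ : ℝ → ℂ} (hγ : E.IsGenerator γ) :
    ∫ τ in (0 : ℝ)..2 * Real.pi, θ (γ τ) * deriv γ τ = 2 * Real.pi * I * deriv k 0 := by
  have h0 : (0 : ℂ) ∈ Metric.ball (0 : ℂ) E.r := Metric.mem_ball_self E.r_pos
  have hk1 : DifferentiableOn ℂ (dslope k 0) (Metric.ball 0 E.r) :=
    (Complex.differentiableOn_dslope E.ball_mem_nhds).mpr hk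
  have hk2 : DifferentiableOn ℂ (dslope (dslope k 0) 0) (Metric.ball 0 E.r) :=
    (Complex.differentiableOn_dslope E.ball_mem_nhds).mpr hk1
  obtain ⟨M, hM⟩ := hk2.isExactOn_ball
  have hγ0 : ∀ τ, γ τ ≠ 0 := fun τ => (hγ.mem τ).2
  have hγb : ∀ τ, γ τ ∈ Metric.ball (0 : ℂ) E.r := fun τ => (hγ.mem τ).1
  have hγd : ∀ τ, HasDerivAt γ (deriv γ τ) τ := fun τ =>
    (hγ.smooth.differentiable (by simp) τ).hasDerivAt
  have hγc : Continuous γ := hγ.smooth.continuous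
  have hγ'c : Continuous (deriv γ) := hγ.smooth.continuous_deriv (by simp)
  have hdec : ∀ z ∈ E.disc,
      θ z = (k 0 / z ^ 2 + dslope (dslope k 0) 0 z) + deriv k 0 / z := by
    intro z hz
    have hz0 : z ≠ 0 := hz.2
    rw [hθ z hz, dslope_of_ne _ hz0, slope_def_field, dslope_same, dslope_of_ne _ hz0,
      slope_def_field]
    field_simp
    ring
  have hP : ∀ τ, HasDerivAt (fun τ => -k 0 / γ τ + M (γ τ))
      ((k 0 / γ τ ^ 2 + dslope (dslope k 0) 0 (γ τ)) * deriv γ τ) τ := by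
    intro τ
    have h1 : HasDerivAt (fun τ => -k 0 / γ τ) _ τ :=
      (hasDerivAt_const τ (-k 0)).div (hγd τ) (hγ0 τ)
    have h2 : HasDerivAt (fun τ => M (γ τ)) _ τ := (hM _ (hγb τ)).comp τ (hγd τ)
    refine (h1.add h2).congr_deriv ?_
    have := hγ0 τ
    field_simp
    ring
  have hPc : Continuous fun τ => (k 0 / γ τ ^ 2 + dslope (dslope k 0) 0 (γ τ)) * deriv γ τ := by
    refine ((continuous_const.div (hγc.pow 2) fun τ => pow_ne_zero 2 (hγ0 τ)).add ?_).mul hγ'c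
    exact continuous_iff_continuousAt.mpr fun τ =>
      (((hk2.differentiableAt (Metric.isOpen_ball.mem_nhds (hγb τ))).continuousAt).comp
        hγc.continuousAt)
  have hI := intervalIntegral.integral_eq_sub_of_hasDerivAt (a := 0) (b := 2 * Real.pi)
    (fun τ _ => hP τ) (hPc.intervalIntegrable _ _)
  have hper : γ (2 * Real.pi) = γ 0 := by simpa using hγ.periodic 0
  simp only [hper, sub_self] at hI
  have hsplit : ∀ τ, θ (γ τ) * deriv γ τ =
      (k 0 / γ τ ^ 2 + dslope (dslope k 0) 0 (γ τ)) * deriv γ τ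
        + deriv k 0 * (deriv γ τ / γ τ) := by
    intro τ
    rw [hdec _ (hγ.mem τ)]
    ring
  simp only [hsplit]
  have hQc : Continuous fun τ => deriv k 0 * (deriv γ τ / γ τ) :=
    continuous_const.mul (hγ'c.div hγc hγ0)
  rw [intervalIntegral.integral_add (hPc.intervalIntegrable _ _) (hQc.intervalIntegrable _ _), hI,
    intervalIntegral.integral_const_mul, hγ.winding]
  ring

theorem isGenerator_circleMap : E.IsGenerator (circleMap 0 (E.r / 2)) where
  smooth := contDiff_circleMap 0 (E.r / 2)
  periodic := periodic_circleMap 0 (E.r / 2)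
  regular τ := by
    have := E.r_pos
    rw [deriv_circleMap]
    exact mul_ne_zero (circleMap_ne_center (by positivity)) I_ne_zero
  mem τ := by
    have := E.r_pos
    refine ⟨?_, ?_⟩
    · rw [mem_ball_zero_iff, norm_circleMap_zero, abs_of_pos (by positivity)]
      linarith
    · exact circleMap_ne_center (by positivity)
  winding := by
    have h : ∀ τ, circleMap (0 : ℂ) (E.r / 2) τ ≠ 0 := fun τ =>
      circleMap_ne_center (by have := E.r_pos; positivity)
    simp only [deriv_circleMap]
    simp only [mul_comm _ I, mul_div_assoc, div_self (h _)]
    simp [mul_comm I]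

theorem residue_eq {θ k : ℂ → ℂ} (hk : DifferentiableOn ℂ k (Metric.ball 0 E.r))
    (hθ : ∀ z ∈ E.disc, θ z = k z / z ^ 2) : E.residue θ = deriv k 0 := by
  have h := E.integral_generator hk hθ E.isGenerator_circleMap
  unfold residue circleIntegral
  simp only [smul_eq_mul, mul_comm _ (θ _)]
  rw [h, ← mul_assoc, inv_mul_cancel₀, one_mul]
  simp [Real.pi_ne_zero]

/-- The upper half-space is convex, so a collar of the image of the circle can be contracted to the
point $(0,1)$ with a cutoff function. -/
theorem exists_isSpanningDisc : ∃ K, E.IsSpanningDisc (circleMap 0 (E.r / 2)) K := by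
  have hr := E.r_pos
  -- The cutoff equals 1 on the unit circle and is supported in $1/2\le|z|^2\le 3/2$. There `s z`
  -- stays well inside the punctured disc, so the values of `E.X` at and beyond the puncture are
  -- never used.
  let χ : ContDiffBump (1 : ℝ) := ⟨1 / 4, 1 / 2, by norm_num, by norm_num⟩
  let ρ : ℂ → ℝ := fun z => χ (‖z‖ ^ 2)
  have hρ : ContDiff ℝ ((⊤ : ℕ∞) : WithTop ℕ∞) ρ :=
    χ.contDiff.comp (contDiff_norm_sq ℝ)
  -- The conjugation produces the reversed boundary orientation required of a spanning disc.
  let s : ℂ → ℂ := fun z => (E.r / 2 : ℝ) * conj z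
  have hs : ContDiff ℝ ((⊤ : ℕ∞) : WithTop ℕ∞) s :=
    contDiff_const.mul Complex.conjCLE.contDiff
  have hnorm : ∀ z, ‖s z‖ = E.r / 2 * ‖z‖ := by
    intro z
    simp only [s, norm_mul, Complex.norm_real, Complex.norm_conj]
    rw [Real.norm_of_nonneg (by positivity)]
  have hdisc : ∀ z : ℂ, 1 / 4 < ‖z‖ ^ 2 → ‖z‖ ^ 2 < 4 → s z ∈ E.disc := by
    intro z h1 h2
    have hz2 : ‖z‖ < 2 := by nlinarith [norm_nonneg z]
    have hz0 : 0 < ‖z‖ := by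
      rcases (norm_nonneg z).eq_or_lt with h | h
      · rw [← h] at h1; norm_num at h1
      · exact h
    refine ⟨?_, ?_⟩
    · rw [mem_ball_zero_iff, hnorm]
      nlinarith
    · intro h
      have h' : s z = 0 := h
      have := hnorm z
      rw [h', norm_zero] at this
      have : 0 < E.r / 2 * ‖z‖ := by positivity
      linarith
  let p₀ : ℂ × ℝ := (0, 1)
  let K : ℂ → ℂ × ℝ := fun z => p₀ + ρ z • (E.X (s z) - p₀)
  have hρ0 : ∀ z : ℂ, ¬ (1 / 2 < ‖z‖ ^ 2 ∧ ‖z‖ ^ 2 < 3 / 2) → ρ z = 0 := by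
    intro z hz
    apply χ.zero_of_le_dist
    rw [Real.dist_eq]
    by_contra h
    push Not at h
    have : |‖z‖ ^ 2 - 1| < 1 / 2 := h
    rw [abs_lt] at this
    exact hz ⟨by linarith, by linarith⟩
  refine ⟨K, ?_, ?_, ?_⟩
  · rw [contDiff_iff_contDiffAt]
    intro z
    by_cases h : 1 / 4 < ‖z‖ ^ 2 ∧ ‖z‖ ^ 2 < 4
    · exact contDiffAt_const.add (hρ.contDiffAt.smul
        (((E.contDiffAt_X (hdisc z h.1 h.2)).comp z hs.contDiffAt).sub contDiffAt_const))
    · have hev : ∀ᶠ y in 𝓝 z, ¬ (1 / 2 < ‖y‖ ^ 2 ∧ ‖y‖ ^ 2 < 3 / 2) := by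
        have hc : Continuous fun y : ℂ => ‖y‖ ^ 2 := by fun_prop
        rw [not_and_or, not_lt, not_lt] at h
        rcases h with h | h
        · filter_upwards [hc.continuousAt.eventually_lt (continuousAt_const (y := (1 / 2 : ℝ)))
            (by linarith)] with y hy hy'
          linarith [hy'.1]
        · filter_upwards [(continuousAt_const (y := (3 / 2 : ℝ))).eventually_lt hc.continuousAt
            (by linarith)] with y hy hy'
          linarith [hy'.2]
      refine (contDiffAt_const (c := p₀)).congr_of_eventuallyEq ?_
      filter_upwards [hev] with y hy
      simp [K, hρ0 y hy]
  · intro z hz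
    have h01 : 0 ≤ ρ z ∧ ρ z ≤ 1 := ⟨χ.nonneg, χ.le_one⟩
    show 0 < (K z).2
    by_cases h : 1 / 2 < ‖z‖ ^ 2 ∧ ‖z‖ ^ 2 < 3 / 2
    · have hX : 0 < (E.X (s z)).2 := E.X_mem_space (hdisc z (by linarith) (by linarith))
      simp only [K, p₀, Prod.snd_add, Prod.smul_snd, Prod.snd_sub, smul_eq_mul]
      rcases h01.1.eq_or_lt with h' | h'
      · rw [← h']; norm_num
      · nlinarith [mul_pos h' hX]
    · simp [K, hρ0 z h, p₀]
  · intro τ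
    have h1 : ‖exp (-(τ * I))‖ = 1 := by
      rw [← neg_mul, ← Complex.ofReal_neg, Complex.norm_exp_ofReal_mul_I]
    have h2 : ρ (exp (-(τ * I))) = 1 := by
      apply χ.one_of_mem_closedBall
      rw [h1]
      simp [χ.rIn_pos.le]
    have h3 : s (exp (-(τ * I))) = circleMap 0 (E.r / 2) τ := by
      simp only [s, circleMap, ← Complex.exp_conj]
      simp
    simp [K, h2, h3]

/-- The flux is $2\operatorname{Im}\oint$ of the flux form, that is $2\operatorname{Im}(2\pi
i\,k'(0))$; this depends on neither the loop nor the disc. -/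
theorem hasFlux_of_fluxForm_eq {a b c : ℂ} {k : ℂ → ℂ}
    (hk : DifferentiableOn ℂ k (Metric.ball 0 E.r))
    (hθ : ∀ z ∈ E.disc, E.fluxForm a b c z = k z / z ^ 2) {Y : ℂ × ℝ → ℂ × ℝ}
    (hY : ∀ p ∈ H3.space, Y p = H3.killing a b c p) :
    E.HasFlux Y (4 * Real.pi * (deriv k 0).re) := by
  obtain ⟨K₀, hK₀⟩ := E.exists_isSpanningDisc
  refine ⟨⟨_, K₀, E.isGenerator_circleMap, hK₀⟩, fun γ K hγ hK => ?_⟩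
  have hγd : ∀ τ, γ τ ∈ E.disc := hγ.mem
  have hγc : Continuous γ := hγ.smooth.continuous
  have hγ'c : Continuous (deriv γ) := hγ.smooth.continuous_deriv (by simp)
  have hdX : ∀ v : ℝ → ℂ, Continuous v → Continuous fun τ => fderiv ℝ E.X (γ τ) (v τ) := by
    intro v hv
    refine Continuous.clm_apply (continuous_iff_continuousAt.mpr fun τ => ?_) hv
    exact (((E.contDiffAt_X (hγd τ)).fderiv_right (m := 0) (by simp)).continuousAt).comp
      hγc.continuousAt
  have hXc : Continuous fun τ => E.X (γ τ) := continuous_iff_continuousAt.mpr fun τ =>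
    (E.contDiffAt_X (hγd τ)).continuousAt.comp hγc.continuousAt
  have hdual : ∀ (a b c : ℂ) (v : ℝ → ℂ), Continuous v → Continuous fun τ =>
      H3.dualForm a b c (E.X (γ τ)) (fderiv ℝ E.X (γ τ) (v τ)) := by
    intro a b c v hv
    refine continuous_iff_continuousAt.mpr fun τ => ?_
    exact (H3.contDiffAt_dualForm a b c
      (q := (E.X (γ τ), fderiv ℝ E.X (γ τ) (v τ))) (E.X_mem_space (hγd τ))).continuousAt.comp
      (f := fun τ => (E.X (γ τ), fderiv ℝ E.X (γ τ) (v τ)))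
      (hXc.prodMk (hdX v hv)).continuousAt
  -- The pairing with `Y` is itself a dual form with coefficients multiplied by $-i$, so one
  -- continuity statement covers both integrands.
  have hcon : E.conormalIntegral Y γ = ∫ τ in (0 : ℝ)..2 * Real.pi,
      H3.dualForm (-I * a) (-I * b) (-I * c) (E.X (γ τ))
        (fderiv ℝ E.X (γ τ) (I * deriv γ τ)) := by
    unfold conormalIntegral
    refine intervalIntegral.integral_congr fun τ _ => ?_
    simp only [E.conormal_integrand_eq Y (hγd τ)]
    rw [hY _ (E.X_mem_space (hγd τ))]
    simp only [H3.dualForm, ← mul_assoc, mul_neg, neg_mul, I_mul_I, neg_neg, one_mul]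
  rw [hcon, E.two_mul_discIntegral hγ hK hY, sub_neg_eq_add, ← intervalIntegral.integral_add
    ((hdual _ _ _ (fun τ => I * deriv γ τ) (continuous_const.mul hγ'c)).intervalIntegrable _ _)
    ((hdual _ _ _ _ hγ'c).intervalIntegrable _ _)]
  have hpt : ∀ τ, H3.dualForm (-I * a) (-I * b) (-I * c) (E.X (γ τ))
        (fderiv ℝ E.X (γ τ) (I * deriv γ τ))
      + H3.dualForm a b c (E.X (γ τ)) (fderiv ℝ E.X (γ τ) (deriv γ τ)) =
      2 * Complex.imCLM (E.fluxForm a b c (γ τ) * deriv γ τ) := by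
    intro τ
    rw [Complex.imCLM_apply, ← E.inner_add_dualForm_eq_fluxForm a b c (hγd τ)]
    simp only [H3.dualForm, ← mul_assoc, mul_neg, neg_mul, I_mul_I, neg_neg, one_mul]
  have hc : Continuous fun τ => E.fluxForm a b c (γ τ) * deriv γ τ := by
    have : ∀ τ, E.fluxForm a b c (γ τ) * deriv γ τ = k (γ τ) / γ τ ^ 2 * deriv γ τ := fun τ => by
      rw [hθ _ (hγd τ)]
    simp only [this]
    refine Continuous.mul (Continuous.div ?_ (hγc.pow 2) fun τ => pow_ne_zero 2 (hγd τ).2) hγ'c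
    exact continuous_iff_continuousAt.mpr fun τ =>
      ((hk.differentiableAt (Metric.isOpen_ball.mem_nhds (hγd τ).1)).continuousAt).comp
        hγc.continuousAt
  simp only [hpt]
  rw [intervalIntegral.integral_const_mul,
    ContinuousLinearMap.intervalIntegral_comp_comm _ (hc.intervalIntegrable _ _),
    E.integral_generator hk hθ hγ, Complex.imCLM_apply]
  simp
  ring

end BryantEnd

/-! ### Punctured neighbourhoods, conjugation, and reduction to direct isometries. -/

/-- An identity valid near the puncture holds in a full neighbourhood of each nearby point other
than the puncture, so it may be differentiated there. -/
theorem eventually_nhds_of_eventually_nhdsNE {p : ℂ → Prop} {x : ℂ} (h : ∀ᶠ z in 𝓝[≠] x, p z) :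
    ∀ᶠ z in 𝓝[≠] x, ∀ᶠ y in 𝓝 z, p y := by
  have h1 := eventually_eventually_nhdsWithin.mpr h
  filter_upwards [h1, self_mem_nhdsWithin] with z hz hz0
  rwa [isOpen_compl_singleton.nhdsWithin_eq hz0] at hz

theorem tendsto_nhdsNE_of_deriv_ne_zero {φ : ℂ → ℂ} {x y : ℂ} (hφ : AnalyticAt ℂ φ x)
    (h0 : φ x = y) (h' : deriv φ x ≠ 0) : Tendsto φ (𝓝[≠] x) (𝓝[≠] y) := by
  refine tendsto_nhdsWithin_iff.mpr ⟨?_, ?_⟩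
  · exact (h0 ▸ hφ.continuousAt.tendsto).mono_left nhdsWithin_le_nhds
  · exact h0 ▸ hφ.differentiableAt.hasDerivAt.eventually_ne h'

theorem analyticAt_conj_conj {f : ℂ → ℂ} (hf : AnalyticAt ℂ f 0) :
    AnalyticAt ℂ (fun z => conj (f (conj z))) 0 := by
  rw [Complex.analyticAt_iff_eventually_differentiableAt] at hf ⊢
  have hc : Tendsto (fun z : ℂ => conj z) (𝓝 0) (𝓝 0) := by
    simpa using (Complex.continuous_conj.tendsto 0)
  filter_upwards [hc.eventually hf] with z hz
  have := hz.conj_conj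
  rwa [Complex.conj_conj] at this

theorem tendsto_conj_nhdsNE : Tendsto (fun z : ℂ => conj z) (𝓝[≠] 0) (𝓝[≠] 0) := by
  refine tendsto_nhdsWithin_iff.mpr ⟨?_, ?_⟩
  · have : Tendsto (fun z : ℂ => conj z) (𝓝 0) (𝓝 0) := by
      simpa using (Complex.continuous_conj.tendsto 0)
    exact this.mono_left nhdsWithin_le_nhds
  · filter_upwards [self_mem_nhdsWithin] with z hz
    simpa using hz

theorem differentiableOn_conj_conj {f : ℂ → ℂ} {r : ℝ}
    (hf : DifferentiableOn ℂ f (Metric.ball 0 r \ {0})) :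
    DifferentiableOn ℂ (fun z => conj (f (conj z))) (Metric.ball 0 r \ {0}) := by
  intro z hz
  have ho : IsOpen (Metric.ball (0 : ℂ) r \ {0}) := Metric.isOpen_ball.sdiff isClosed_singleton
  have h1 : DifferentiableAt ℂ f (conj z) :=
    hf.differentiableAt (ho.mem_nhds (by simpa using hz))
  exact (differentiableAt_conj_conj_iff.mpr h1).differentiableWithinAt

theorem deriv_conj_conj_apply (f : ℂ → ℂ) (z : ℂ) :
    deriv (fun z => conj (f (conj z))) z = conj (deriv f (conj z)) :=
  congrFun (deriv_conj_conj (f := f)) z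

namespace H3

theorem reflect_mobius (P : Matrix (Fin 2) (Fin 2) ℂ) (x : ℂ × ℝ) :
    reflect (mobius P x) = mobius (P.map conj) (reflect x) := by
  have hn : ∀ a b z : ℂ, ‖conj a * conj z + conj b‖ = ‖a * z + b‖ := by
    intro a b z
    rw [← map_mul, ← map_add, Complex.norm_conj]
  have hd : ‖(P.map conj).det‖ = ‖P.det‖ := by
    rw [← Complex.norm_conj P.det, RingHom.map_det]
    rfl
  unfold reflect mobius
  simp [hn, hd]

theorem reflect_reflect (x : ℂ × ℝ) : reflect (reflect x) = x := by
  simp [reflect]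

end H3

namespace BryantEnd

variable (E : BryantEnd)

/-- The image of an end by the reflection `(ζ, w) ↦ (conj ζ, w)`, parametrized by `conj z`. -/
def conjEnd : BryantEnd where
  r := E.r
  r_pos := E.r_pos
  A z := conj (E.A (conj z))
  B z := conj (E.B (conj z))
  C z := conj (E.C (conj z))
  D z := conj (E.D (conj z))
  holA := differentiableOn_conj_conj E.holA
  holB := differentiableOn_conj_conj E.holB
  holC := differentiableOn_conj_conj E.holC
  holD := differentiableOn_conj_conj E.holD
  det_eq z hz := by
    have := congrArg conj (E.det_eq (conj z) (by simpa using hz))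
    simpa using this
  null z hz := by
    have := congrArg conj (E.null (conj z) (by simpa using hz))
    simp only [deriv_conj_conj_apply]
    simpa using this
  immersion z hz := by
    have := E.immersion (conj z) (by simpa using hz)
    simp only [deriv_conj_conj_apply]
    simpa using this

theorem conjEnd_X (z : ℂ) : E.conjEnd.X z = H3.reflect (E.X (conj z)) := by
  simp [X, conjEnd, H3.reflect]

theorem conjEnd_omega (z : ℂ) : E.conjEnd.omega z = conj (E.omega (conj z)) := by
  simp [omega, conjEnd, deriv_conj_conj_apply]

theorem conjEnd_gauss (z : ℂ) : E.conjEnd.gauss z = conj (E.gauss (conj z)) := by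
  rw [gauss, conjEnd_omega]
  simp [gauss, conjEnd, deriv_conj_conj_apply]

/-- Conjugating all the data keeps the exponent $\mu$ and the normalizations at zero. Indirect
isometries can therefore be absorbed into the model end. -/
theorem IsCanonicalHorospherical.conjEnd {E : BryantEnd} (hE : E.IsCanonicalHorospherical) :
    E.conjEnd.IsCanonicalHorospherical := by
  obtain ⟨μ, h, f₁, f₂, g₁, g₂, b, c, hμ, hb, hc, ha, h0, hf₁, hf₁0, hf₂, hf₂0, hg₁, hg₁0, hg₂,
    hg₂0, hev⟩ := hE
  refine ⟨μ, fun z => conj (h (conj z)), fun z => conj (f₁ (conj z)), fun z => conj (f₂ (conj z)),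
    fun z => conj (g₁ (conj z)), fun z => conj (g₂ (conj z)), conj b, conj c, hμ, by simpa, by simpa,
    analyticAt_conj_conj ha, by simpa, analyticAt_conj_conj hf₁, by simp [hf₁0],
    analyticAt_conj_conj hf₂, by simp [hf₂0], analyticAt_conj_conj hg₁, by simp [hg₁0],
    analyticAt_conj_conj hg₂, by simp [hg₂0], ?_⟩
  filter_upwards [tendsto_conj_nhdsNE.eventually hev] with z hz
  obtain ⟨e1, e2, e3, e4, e5, e6⟩ := hz
  rw [conjEnd_gauss, conjEnd_omega, e1, e2]
  simp [BryantEnd.conjEnd, e3, e4, e5, e6]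

/-- An end of asymptotic boundary `B` agrees near the puncture, up to a direct isometry mapping `B`
to `∞` and a conformal change of parameter, with a canonical horospherical end. -/
theorem IsHorospherical.exists_mobius_X_eq {E : BryantEnd} {B : OnePoint ℂ}
    (hE : E.IsHorospherical B) :
    ∃ E₀ : BryantEnd, E₀.IsCanonicalHorospherical ∧ ∃ (p q s t : ℂ) (ψ : ℂ → ℂ),
      p * t - q * s = 1 ∧ (∀ b : ℂ, B = (b : OnePoint ℂ) → s * b + t = 0) ∧ (B = ∞ → s = 0) ∧
      AnalyticAt ℂ ψ 0 ∧ ψ 0 = 0 ∧ deriv ψ 0 ≠ 0 ∧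
      ∀ᶠ z in 𝓝[≠] (0 : ℂ), H3.mobius !![p, q; s, t] (E.X z) = E₀.X (ψ z) := by
  obtain ⟨E₀, hE₀, P, φ, hφ, hφ0, hφ', h⟩ := hE
  -- The definition parametrizes the given end by `φ`; below, its local inverse `ψ` moves the change
  -- of parameter to the canonical end.
  have hdet : (P : Matrix (Fin 2) (Fin 2) ℂ).det = 1 := P.2
  have hinv : ∃ ψ : ℂ → ℂ, AnalyticAt ℂ ψ 0 ∧ ψ 0 = 0 ∧ deriv ψ 0 ≠ 0 ∧
      ∀ᶠ z in 𝓝 (0 : ℂ), φ (ψ z) = z := by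
    have h1 := hφ.analyticAt_localInverse hφ'
    have h2 := hφ.hasStrictDerivAt.to_localInverse hφ'
    have h3 := HasStrictDerivAt.eventually_right_inverse hφ.hasStrictDerivAt hφ'
    have h4 := (hφ.hasStrictDerivAt.hasStrictFDerivAt_equiv hφ').localInverse_apply_image
    rw [hφ0] at h1 h2 h3
    refine ⟨_, h1, ?_, ?_, h3⟩
    · rw [hφ0] at h4
      exact h4
    · rw [h2.hasDerivAt.deriv]
      exact inv_ne_zero hφ'
  obtain ⟨ψ, hψ, hψ0, hψ', hψφ⟩ := hinv
  have hψt := tendsto_nhdsNE_of_deriv_ne_zero hψ hψ0 hψ'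
  have hψφ' : ∀ᶠ z in 𝓝[≠] (0 : ℂ), φ (ψ z) = z := hψφ.filter_mono nhdsWithin_le_nhds
  rcases h with ⟨hB, hX⟩ | ⟨hB, hX⟩
  · refine ⟨E₀, hE₀, P 0 0, P 0 1, P 1 0, P 1 1, ψ, ?_, ?_, ?_, hψ, hψ0, hψ', ?_⟩
    · rwa [Matrix.det_fin_two] at hdet
    · rintro b rfl
      rw [OnePoint.smul_some_eq_ite] at hB
      by_contra h
      simp [h] at hB
    · rintro rfl
      simpa using OnePoint.smul_infty_eq_self_iff.mp hB
    · filter_upwards [hψt.eventually hX, hψφ'] with z hz hz'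
      rw [← hz, hz', ← Matrix.eta_fin_two]
  -- Reflecting both sides of the congruence conjugates the matrix and cancels the reflection of the
  -- given end.
  · refine ⟨E₀.conjEnd, hE₀.conjEnd, conj (P 0 0), conj (P 0 1), conj (P 1 0), conj (P 1 1), ψ,
      ?_, ?_, ?_, hψ, hψ0, hψ', ?_⟩
    · rw [← map_mul, ← map_mul, ← map_sub, ← Matrix.det_fin_two, hdet, map_one]
    · rintro b rfl
      rw [OnePoint.map_some, OnePoint.smul_some_eq_ite] at hB
      have : P 1 0 * conj b + P 1 1 = 0 := by
        by_contra h
        simp [h] at hB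
      simpa using congrArg conj this
    · rintro rfl
      rw [OnePoint.map_infty] at hB
      simpa using OnePoint.smul_infty_eq_self_iff.mp hB
    · filter_upwards [hψt.eventually hX, hψφ'] with z hz hz'
      rw [conjEnd_X, ← hz, hz', H3.reflect_mobius, H3.reflect_reflect]
      congr 1
      ext i j
      fin_cases i <;> fin_cases j <;> rfl

end BryantEnd

/-! ### Uniqueness of the Bryant representation up to a constant unitary factor. -/

/-- The point of hyperbolic space represented by the matrix `!![A, B; C, D]` of `SL(2, ℂ)`. -/
def bryantPoint (A B C D : ℂ) : ℂ × ℝ :=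
  ((conj A * C + conj B * D) / ((‖A‖ ^ 2 + ‖B‖ ^ 2 : ℝ) : ℂ), 1 / (‖A‖ ^ 2 + ‖B‖ ^ 2))

theorem bryantPoint_denom_pos {A B C D : ℂ} (h : A * D - B * C = 1) :
    0 < ‖A‖ ^ 2 + ‖B‖ ^ 2 := by
  by_cases hA : A = 0
  · have : B ≠ 0 := by
      rintro rfl
      simp [hA] at h
    have := norm_pos_iff.mpr this
    positivity
  · have := norm_pos_iff.mpr hA
    positivity

/-- Direct isometries act by left multiplication on the representing matrix. Rows and columns of the
Möbius matrix are swapped because the height is governed by the first row $(A,B)$. -/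
theorem mobius_bryantPoint {A B C D p q s t : ℂ} (h : A * D - B * C = 1) (hP : p * t - q * s = 1) :
    H3.mobius !![p, q; s, t] (bryantPoint A B C D) =
      bryantPoint (t * A + s * C) (t * B + s * D) (q * A + p * C) (q * B + p * D) := by
  have hn := bryantPoint_denom_pos h
  unfold H3.mobius bryantPoint
  simp only [Matrix.det_fin_two, Matrix.of_apply, Matrix.cons_val', Matrix.cons_val_zero,
    Matrix.cons_val_one, Matrix.cons_val_fin_one, hP, norm_one, one_mul]
  set n : ℝ := ‖A‖ ^ 2 + ‖B‖ ^ 2 with hndef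
  have hn0 : (n : ℂ) ≠ 0 := by exact_mod_cast hn.ne'
  have hnc : (n : ℂ) = A * conj A + B * conj B := by
    rw [hndef, Complex.ofReal_add, H3.ofReal_norm_sq, H3.ofReal_norm_sq]
  set S : ℂ := conj A * C + conj B * D with hS
  have hS' : conj S = A * conj C + B * conj D := by rw [hS]; simp
  have h' := congrArg conj h
  simp only [map_sub, map_mul, map_one] at h'
  -- Lagrange's identity for the two rows of a matrix of determinant one.
  have hm : S * conj S + 1 = n * (C * conj C + D * conj D) := by
    rw [hS', hS, hnc]
    linear_combination -conj A * conj D * h + conj B * conj C * h - h'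
  set N : ℝ := ‖s * (S / n) + t‖ ^ 2 + ‖s‖ ^ 2 * (1 / n) ^ 2 with hN
  have hNc : (N : ℂ) = (s * (S / n) + t) * (conj s * (conj S / n) + conj t)
      + s * conj s * (1 / n) ^ 2 := by
    rw [hN, Complex.ofReal_add, Complex.ofReal_mul, H3.ofReal_norm_sq, H3.ofReal_norm_sq]
    simp
  set n' : ℝ := ‖t * A + s * C‖ ^ 2 + ‖t * B + s * D‖ ^ 2 with hn'
  have hn'c : (n' : ℂ) = (t * A + s * C) * conj (t * A + s * C)
      + (t * B + s * D) * conj (t * B + s * D) := by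
    rw [hn', Complex.ofReal_add, H3.ofReal_norm_sq, H3.ofReal_norm_sq]
  have key : (n' : ℂ) = N * n := by
    rw [hn'c, hNc]
    field_simp
    simp only [map_add, map_mul]
    linear_combination -s * conj s * hm - n * t * conj t * hnc - n * s * conj t * hS
      - n * t * conj s * hS'
  have keyr : n' = N * n := by exact_mod_cast key
  rw [keyr]
  refine Prod.ext ?_ ?_
  · show _ / _ = _ / _
    rw [Complex.ofReal_mul, ← mul_div_mul_right _ (N : ℂ) hn0]
    congr 1
    simp only [map_add, map_mul, map_div₀, Complex.conj_ofReal, Complex.ofReal_div,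
      Complex.ofReal_one]
    field_simp
    linear_combination p * conj s * hm + n * q * conj t * hnc + n * p * conj t * hS
      + n * q * conj s * hS'
  · show _ / _ = _ / _
    rw [← mul_div_mul_right _ N hn.ne', div_mul_cancel₀ _ hn.ne']

/-- The point records the norm of the first row and the Hermitian product of the two rows;
determinant one then fixes the norm of the second row. So equal points give $FF^*=F_1F_1^*$, and
$F_1^{-1}F$ lies in $SU(2)$. -/
theorem unitary_of_bryantPoint_eq {A B C D A₁ B₁ C₁ D₁ : ℂ} (h : A * D - B * C = 1)
    (h₁ : A₁ * D₁ - B₁ * C₁ = 1) (he : bryantPoint A B C D = bryantPoint A₁ B₁ C₁ D₁) :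
    A₁ * D - C₁ * B = conj (D₁ * A - B₁ * C) ∧ A₁ * C - C₁ * A = -conj (D₁ * B - B₁ * D) ∧
      (D₁ * A - B₁ * C) * conj (D₁ * A - B₁ * C) + (D₁ * B - B₁ * D) * conj (D₁ * B - B₁ * D)
        = 1 := by
  have hn := bryantPoint_denom_pos h
  have hn₁ := bryantPoint_denom_pos h₁
  have e2 : ‖A‖ ^ 2 + ‖B‖ ^ 2 = ‖A₁‖ ^ 2 + ‖B₁‖ ^ 2 := by
    have := congrArg Prod.snd he
    simp only [bryantPoint, one_div] at this
    exact inv_injective this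
  have e1 : conj A * C + conj B * D = conj A₁ * C₁ + conj B₁ * D₁ := by
    have := congrArg Prod.fst he
    simp only [bryantPoint] at this
    rw [← e2] at this
    exact (div_left_inj' (by exact_mod_cast hn.ne')).mp this
  have e2c : A * conj A + B * conj B = A₁ * conj A₁ + B₁ * conj B₁ := by
    have := congrArg (fun x : ℝ => (x : ℂ)) e2
    simp only [Complex.ofReal_add, H3.ofReal_norm_sq] at this
    exact this
  have hn0 : A * conj A + B * conj B ≠ 0 := by
    rw [← H3.ofReal_norm_sq, ← H3.ofReal_norm_sq, ← Complex.ofReal_add]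
    exact_mod_cast hn.ne'
  have e1' := congrArg conj e1
  have h' := congrArg conj h
  have h₁' := congrArg conj h₁
  simp only [map_add, map_sub, map_mul, map_one, Complex.conj_conj] at e1' h' h₁' ⊢
  generalize conj A = a at *
  generalize conj B = b at *
  generalize conj C = c at *
  generalize conj D = d at *
  generalize conj A₁ = a₁ at *
  generalize conj B₁ = b₁ at *
  generalize conj C₁ = c₁ at *
  generalize conj D₁ = d₁ at *
  have e3 : C * c + D * d = C₁ * c₁ + D₁ * d₁ := by
    apply mul_left_cancel₀ hn0
    have i1 : (A * a + B * b) * (C * c + D * d) =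
        (a * C + b * D) * (A * c + B * d) + (A * D - B * C) * (a * d - b * c) := by ring
    have i2 : (A₁ * a₁ + B₁ * b₁) * (C₁ * c₁ + D₁ * d₁) =
        (a₁ * C₁ + b₁ * D₁) * (A₁ * c₁ + B₁ * d₁)
          + (A₁ * D₁ - B₁ * C₁) * (a₁ * d₁ - b₁ * c₁) := by ring
    rw [i1, e2c, i2, e1, e1', h, h', h₁, h₁']
  have u1 : (D₁ * A - B₁ * C) * (d₁ * a - b₁ * c) + (D₁ * B - B₁ * D) * (d₁ * b - b₁ * d) = 1 := by
    linear_combination D₁ * d₁ * e2c - D₁ * b₁ * e1' - B₁ * d₁ * e1 + B₁ * b₁ * e3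
      + (a₁ * d₁ - b₁ * c₁) * h₁ + h₁'
  have u2 : (D₁ * A - B₁ * C) * (a₁ * c - c₁ * a) + (D₁ * B - B₁ * D) * (a₁ * d - c₁ * b) = 0 := by
    linear_combination -D₁ * c₁ * e2c + D₁ * a₁ * e1' + B₁ * c₁ * e1 - B₁ * a₁ * e3
  have u3 : (A₁ * C - C₁ * A) * (a₁ * c - c₁ * a) + (A₁ * D - C₁ * B) * (a₁ * d - c₁ * b) = 1 := by
    linear_combination C₁ * c₁ * e2c - C₁ * a₁ * e1' - A₁ * c₁ * e1 + A₁ * a₁ * e3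
      + (a₁ * d₁ - b₁ * c₁) * h₁ + h₁'
  have u2' : (d₁ * a - b₁ * c) * (A₁ * C - C₁ * A) + (d₁ * b - b₁ * d) * (A₁ * D - C₁ * B) = 0 := by
    linear_combination -d₁ * C₁ * e2c + d₁ * A₁ * e1 + b₁ * C₁ * e1' - b₁ * A₁ * e3
  have u4 : (d₁ * a - b₁ * c) * (a₁ * d - c₁ * b) - (d₁ * b - b₁ * d) * (a₁ * c - c₁ * a) = 1 := by
    linear_combination (a₁ * d₁ - b₁ * c₁) * h' + h₁'
  refine ⟨?_, ?_, u1⟩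
  · linear_combination -(A₁ * D - C₁ * B) * u4 + (d₁ * a - b₁ * c) * u3 - (a₁ * c - c₁ * a) * u2'
  · linear_combination -(A₁ * C - C₁ * A) * u4 - (d₁ * b - b₁ * d) * u3 + (a₁ * d - c₁ * b) * u2'

/-- A bounded function which is holomorphic and antiholomorphic on a punctured neighbourhood of
zero is constant there. -/
theorem eventually_eq_const_of_conj {f g : ℂ → ℂ}
    (hf : ∀ᶠ z in 𝓝[≠] (0 : ℂ), DifferentiableAt ℂ f z)
    (hg : ∀ᶠ z in 𝓝[≠] (0 : ℂ), DifferentiableAt ℂ g z)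
    (hfg : ∀ᶠ z in 𝓝[≠] (0 : ℂ), g z = conj (f z)) {M : ℝ}
    (hM : ∀ᶠ z in 𝓝[≠] (0 : ℂ), ‖f z‖ ≤ M) :
    ∃ u : ℂ, ∀ᶠ z in 𝓝[≠] (0 : ℂ), f z = u := by
  have hd : ∀ᶠ z in 𝓝[≠] (0 : ℂ), deriv f z = 0 := by
    filter_upwards [hf, hg, eventually_nhds_of_eventually_nhdsNE hfg] with z h1 h2 h3
    have e1 : HasFDerivAt g (Complex.conjCLE.toContinuousLinearMap.comp
        ((ContinuousLinearMap.toSpanSingleton ℂ (deriv f z)).restrictScalars ℝ)) z := by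
      have := Complex.conjCLE.toContinuousLinearMap.hasFDerivAt.comp z
        (h1.hasDerivAt.hasFDerivAt.restrictScalars ℝ)
      exact this.congr_of_eventuallyEq h3
    have e2 := h2.hasDerivAt.hasFDerivAt.restrictScalars ℝ
    have e3 := e1.unique e2
    have f1 := congrArg (fun L : ℂ →L[ℝ] ℂ => L 1) e3
    have f2 := congrArg (fun L : ℂ →L[ℝ] ℂ => L I) e3
    simp at f1 f2
    rw [← f1] at f2
    -- The real differential is both complex linear and antilinear; comparing its values at $1$ and
    -- $i$ forces the derivative to vanish.
    have f3 : (2 * I) * conj (deriv f z) = 0 := by linear_combination -f2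
    simpa using f3
  have hall := hf.and (hd.and hM)
  obtain ⟨ε, hε, hball⟩ := Metric.mem_nhdsWithin_iff.mp hall
  have hsub : ∀ z ∈ Metric.ball (0 : ℂ) ε \ {0}, DifferentiableAt ℂ f z ∧ deriv f z = 0 ∧ ‖f z‖ ≤ M :=
    fun z hz => hball ⟨hz.1, hz.2⟩
  have hmem : Metric.ball (0 : ℂ) ε ∈ 𝓝 (0 : ℂ) := Metric.ball_mem_nhds _ hε
  have hF := Complex.differentiableOn_update_limUnder_of_bddAbove hmem
    (fun z hz => (hsub z hz).1.differentiableWithinAt)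
    ⟨M, by rintro _ ⟨z, hz, rfl⟩; exact (hsub z hz).2.2⟩
  -- Boundedness removes the singularity, so constancy can be deduced on a full ball, which is
  -- convex.
  set F := Function.update f 0 (limUnder (𝓝[≠] 0) f) with hFdef
  have hFf : ∀ z, z ≠ 0 → F z = f z := fun z hz => Function.update_of_ne hz _ _
  have hF' : ∀ z ∈ Metric.ball (0 : ℂ) ε \ {0}, deriv F z = 0 := by
    intro z hz
    rw [← (hsub z hz).2.1]
    apply EventuallyEq.deriv_eq
    filter_upwards [isOpen_compl_singleton.mem_nhds hz.2] with y hy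
    exact hFf y hy
  have hF'0 : deriv F 0 = 0 := by
    have hc : ContinuousAt (deriv F) 0 :=
      ((hF.deriv Metric.isOpen_ball).continuousOn.continuousAt hmem)
    refine tendsto_nhds_unique (hc.tendsto.mono_left (nhdsWithin_le_nhds (s := {0}ᶜ)))
      (tendsto_const_nhds.congr' ?_)
    filter_upwards [mem_nhdsWithin_of_mem_nhds hmem, self_mem_nhdsWithin] with z h1 h2
    exact (hF' z ⟨h1, h2⟩).symm
  have hconst : ∀ z ∈ Metric.ball (0 : ℂ) ε, F z = F 0 := by
    intro z hz
    refine Metric.isOpen_ball.is_const_of_deriv_eq_zero (convex_ball _ _).isPreconnected hF ?_ hz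
      (Metric.mem_ball_self hε)
    intro y hy
    by_cases h : y = 0
    · rw [h]; exact hF'0
    · exact hF' y ⟨hy, h⟩
  refine ⟨F 0, ?_⟩
  filter_upwards [mem_nhdsWithin_of_mem_nhds hmem, self_mem_nhdsWithin] with z h1 h2
  rw [← hFf z h2, hconst z h1]

namespace BryantEnd

theorem disc_mem_nhdsNE (E : BryantEnd) : E.disc ∈ 𝓝[≠] (0 : ℂ) :=
  inter_mem (mem_nhdsWithin_of_mem_nhds E.ball_mem_nhds) self_mem_nhdsWithin

/-- The Bryant representation of a horospherical end near the puncture, in terms of that of a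
canonical end. -/
theorem IsHorospherical.exists_local_form {E : BryantEnd} {B : OnePoint ℂ}
    (hE : E.IsHorospherical B) :
    ∃ E₀ : BryantEnd, E₀.IsCanonicalHorospherical ∧ ∃ (p q s t u v : ℂ) (ψ : ℂ → ℂ),
      p * t - q * s = 1 ∧ (∀ b : ℂ, B = (b : OnePoint ℂ) → s * b + t = 0) ∧ (B = ∞ → s = 0) ∧
      u * conj u + v * conj v = 1 ∧ AnalyticAt ℂ ψ 0 ∧ ψ 0 = 0 ∧ deriv ψ 0 ≠ 0 ∧
      ∀ᶠ z in 𝓝[≠] (0 : ℂ),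
        E.A z = (p * E₀.A (ψ z) - s * E₀.C (ψ z)) * u
          - (p * E₀.B (ψ z) - s * E₀.D (ψ z)) * conj v ∧
        E.B z = (p * E₀.A (ψ z) - s * E₀.C (ψ z)) * v
          + (p * E₀.B (ψ z) - s * E₀.D (ψ z)) * conj u ∧
        E.C z = (t * E₀.C (ψ z) - q * E₀.A (ψ z)) * u
          - (t * E₀.D (ψ z) - q * E₀.B (ψ z)) * conj v ∧
        E.D z = (t * E₀.C (ψ z) - q * E₀.A (ψ z)) * v
          + (t * E₀.D (ψ z) - q * E₀.B (ψ z)) * conj u := by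
  obtain ⟨E₀, hE₀, p, q, s, t, ψ, hP, hB, hB', hψ, hψ0, hψ', hX⟩ := hE.exists_mobius_X_eq
  have hψt := tendsto_nhdsNE_of_deriv_ne_zero hψ hψ0 hψ'
  have hz0 : ∀ᶠ z in 𝓝[≠] (0 : ℂ), ψ z ∈ E₀.disc := hψt.eventually E₀.disc_mem_nhdsNE
  have hz1 : ∀ᶠ z in 𝓝[≠] (0 : ℂ), z ∈ E.disc := E.disc_mem_nhdsNE
  have hψd : ∀ᶠ z in 𝓝[≠] (0 : ℂ), DifferentiableAt ℂ ψ z :=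
    (hψ.eventually_analyticAt.mono fun z hz => hz.differentiableAt).filter_mono nhdsWithin_le_nhds
  set GA : ℂ → ℂ := fun z => t * E.A z + s * E.C z with hGA
  set GB : ℂ → ℂ := fun z => t * E.B z + s * E.D z with hGB
  set GC : ℂ → ℂ := fun z => q * E.A z + p * E.C z with hGC
  set GD : ℂ → ℂ := fun z => q * E.B z + p * E.D z with hGD
  -- `U`, `V`, `W`, `Y` are the entries of $F_0(\psi)^{-1}$ times the transformed $F$. They are
  -- holomorphic, and unitarity makes `Y` and `-W` the conjugates of `U` and `V`, so the latter two
  -- are constant.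
  set U : ℂ → ℂ := fun z => E₀.D (ψ z) * GA z - E₀.B (ψ z) * GC z with hU
  set V : ℂ → ℂ := fun z => E₀.D (ψ z) * GB z - E₀.B (ψ z) * GD z with hV
  set W : ℂ → ℂ := fun z => E₀.A (ψ z) * GC z - E₀.C (ψ z) * GA z with hW
  set Y : ℂ → ℂ := fun z => E₀.A (ψ z) * GD z - E₀.C (ψ z) * GB z with hY
  have hdiff : ∀ᶠ z in 𝓝[≠] (0 : ℂ), DifferentiableAt ℂ U z ∧ DifferentiableAt ℂ V z ∧
      DifferentiableAt ℂ W z ∧ DifferentiableAt ℂ Y z := by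
    filter_upwards [hz0, hz1, hψd] with z h0 h1 h2
    have d0 : ∀ {f : ℂ → ℂ}, DifferentiableOn ℂ f E₀.disc →
        DifferentiableAt ℂ (fun z => f (ψ z)) z := fun hf =>
      (hf.differentiableAt (E₀.isOpen_disc.mem_nhds h0)).comp z h2
    have d1 : ∀ {f : ℂ → ℂ}, DifferentiableOn ℂ f E.disc → DifferentiableAt ℂ f z := fun hf =>
      hf.differentiableAt (E.isOpen_disc.mem_nhds h1)
    have a0 := d0 E₀.holA
    have b0 := d0 E₀.holB
    have c0 := d0 E₀.holC
    have e0 := d0 E₀.holD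
    have a1 := d1 E.holA
    have b1 := d1 E.holB
    have c1 := d1 E.holC
    have e1 := d1 E.holD
    simp only [hU, hV, hW, hY, hGA, hGB, hGC, hGD]
    refine ⟨?_, ?_, ?_, ?_⟩ <;> fun_prop
  have hunit : ∀ᶠ z in 𝓝[≠] (0 : ℂ), Y z = conj (U z) ∧ W z = -conj (V z) ∧
      U z * conj (U z) + V z * conj (V z) = 1 := by
    filter_upwards [hz0, hz1, hX] with z h0 h1 h2
    have d1 := E.det_eq z h1
    refine unitary_of_bryantPoint_eq ?_ (E₀.det_eq _ h0) ?_
    · linear_combination (p * t - q * s) * d1 + hP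
    · rw [← mobius_bryantPoint d1 hP]
      exact h2
  have hbd : ∀ᶠ z in 𝓝[≠] (0 : ℂ), ‖U z‖ ≤ 1 ∧ ‖V z‖ ≤ 1 := by
    filter_upwards [hunit] with z hz
    have h1 := hz.2.2
    rw [← H3.ofReal_norm_sq, ← H3.ofReal_norm_sq, ← Complex.ofReal_add] at h1
    have h2 : ‖U z‖ ^ 2 + ‖V z‖ ^ 2 = 1 := by exact_mod_cast h1
    constructor <;> nlinarith [norm_nonneg (U z), norm_nonneg (V z)]
  obtain ⟨u, hu⟩ := eventually_eq_const_of_conj (hdiff.mono fun z h => h.1)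
    (hdiff.mono fun z h => h.2.2.2) (hunit.mono fun z h => h.1) (hbd.mono fun z h => h.1)
  obtain ⟨v, hv⟩ := eventually_eq_const_of_conj (g := fun z => -W z) (hdiff.mono fun z h => h.2.1)
    (hdiff.mono fun z h => h.2.2.1.neg) (hunit.mono fun z h => by rw [h.2.1, neg_neg])
    (hbd.mono fun z h => h.2)
  have huv : u * conj u + v * conj v = 1 := by
    obtain ⟨z, h1, h2, h3⟩ := (hu.and (hv.and hunit)).exists
    rw [← h1, ← h2]
    exact h3.2.2
  refine ⟨E₀, hE₀, p, q, s, t, u, v, ψ, hP, hB, hB', huv, hψ, hψ0, hψ', ?_⟩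
  filter_upwards [hu, hv, hunit, hz0] with z h1 h2 h3 h0
  have d0 := E₀.det_eq _ h0
  obtain ⟨h4, h5, -⟩ := h3
  rw [h1] at h4
  rw [h2] at h5
  simp only [hU, hV, hW, hY] at h1 h2 h4 h5
  have gA : GA z = E₀.A (ψ z) * u - E₀.B (ψ z) * conj v := by
    linear_combination -GA z * d0 + E₀.A (ψ z) * h1 + E₀.B (ψ z) * h5
  have gB : GB z = E₀.A (ψ z) * v + E₀.B (ψ z) * conj u := by
    linear_combination -GB z * d0 + E₀.A (ψ z) * h2 + E₀.B (ψ z) * h4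
  have gC : GC z = E₀.C (ψ z) * u - E₀.D (ψ z) * conj v := by
    linear_combination -GC z * d0 + E₀.C (ψ z) * h1 + E₀.D (ψ z) * h5
  have gD : GD z = E₀.C (ψ z) * v + E₀.D (ψ z) * conj u := by
    linear_combination -GD z * d0 + E₀.C (ψ z) * h2 + E₀.D (ψ z) * h4
  simp only [hGA, hGB, hGC, hGD] at gA gB gC gD
  refine ⟨?_, ?_, ?_, ?_⟩
  · linear_combination -E.A z * hP + p * gA - s * gC
  · linear_combination -E.B z * hP + p * gB - s * gD
  · linear_combination -E.C z * hP + t * gC - q * gA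
  · linear_combination -E.D z * hP + t * gD - q * gB

end BryantEnd

/-! ### Residues under reparametrization and expansions at a canonical end. -/

/-- With $\psi=z\chi$, the factor $\psi'/\chi^2$ has zero derivative at $0$, since
$\psi''(0)=2\chi'(0)$. Hence $k(0)$ does not leak into the residue, which is invariant under the
change of parameter. -/
theorem exists_double_pole_pullback {w k ψ : ℂ → ℂ} (hw : AnalyticAt ℂ w 0) (hk : AnalyticAt ℂ k 0)
    (hψ : AnalyticAt ℂ ψ 0) (h0 : ψ 0 = 0) (h' : deriv ψ 0 ≠ 0) (a : ℂ) :
    ∃ K : ℂ → ℂ, AnalyticAt ℂ K 0 ∧ deriv K 0 = a * deriv k 0 ∧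
      ∀ᶠ z in 𝓝[≠] (0 : ℂ), (w (ψ z) + a * (k (ψ z) / ψ z ^ 2)) * deriv ψ z = K z / z ^ 2 := by
  set χ : ℂ → ℂ := dslope ψ 0 with hχdef
  have hχ : AnalyticAt ℂ χ 0 := by
    obtain ⟨p, hp⟩ := hψ
    exact ⟨_, hp.has_fpower_series_dslope_fslope⟩
  have hψχ : ∀ z, ψ z = z * χ z := by
    intro z
    have := sub_smul_dslope ψ 0 z
    rw [h0, sub_zero, sub_zero, smul_eq_mul] at this
    exact this.symm
  have hχ0 : χ 0 ≠ 0 := by rwa [hχdef, dslope_same]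
  have hψ'eq : ∀ᶠ z in 𝓝 (0 : ℂ), deriv ψ z = χ z + z * deriv χ z := by
    filter_upwards [hχ.eventually_analyticAt] with z hz
    have h1 := (hasDerivAt_id z).mul hz.differentiableAt.hasDerivAt
    have h2 : ψ = id * χ := funext hψχ
    rw [h2, h1.deriv]
    simp
  have hψ'' : HasDerivAt (deriv ψ) (2 * deriv χ 0) 0 := by
    have h1 := hχ.differentiableAt.hasDerivAt.add
      ((hasDerivAt_id (0 : ℂ)).mul hχ.deriv.differentiableAt.hasDerivAt)
    refine (h1.congr_of_eventuallyEq hψ'eq).congr_deriv ?_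
    simp
    ring
  have hw' : AnalyticAt ℂ (fun z => w (ψ z)) 0 := AnalyticAt.comp (by rwa [h0]) hψ
  have hk0 : AnalyticAt ℂ k (ψ 0) := by rwa [h0]
  have hk' : AnalyticAt ℂ (fun z => k (ψ z)) 0 := hk0.comp hψ
  have hkd : HasDerivAt (fun z => k (ψ z)) (deriv k 0 * deriv ψ 0) 0 := by
    have := hk0.differentiableAt.hasDerivAt.comp 0 hψ.differentiableAt.hasDerivAt
    rwa [h0] at this
  have e1 : deriv ψ 0 = χ 0 := by rw [hχdef, dslope_same]
  refine ⟨fun z => z ^ 2 * (w (ψ z) * deriv ψ z) + a * (k (ψ z) * deriv ψ z / χ z ^ 2), ?_, ?_, ?_⟩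
  · exact ((analyticAt_id.pow 2).mul (hw'.mul hψ.deriv)).add
      (analyticAt_const.mul ((hk'.mul hψ.deriv).div (hχ.pow 2) (pow_ne_zero 2 hχ0)))
  · have d1 := ((hasDerivAt_id (0 : ℂ)).pow 2).mul (hw'.mul hψ.deriv).differentiableAt.hasDerivAt
    have d2 := ((hkd.mul hψ'').div (hχ.differentiableAt.hasDerivAt.pow 2)
      (pow_ne_zero 2 hχ0)).const_mul a
    refine (d1.add d2).deriv.trans ?_
    simp only [Pi.mul_apply, Pi.pow_apply, id, h0, e1]
    field_simp
    ring
  · have hχne : ∀ᶠ z in 𝓝[≠] (0 : ℂ), χ z ≠ 0 :=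
      (hχ.continuousAt.eventually_ne hχ0).filter_mono nhdsWithin_le_nhds
    filter_upwards [hχne, self_mem_nhdsWithin] with z h1 h2
    have h2' : z ≠ 0 := h2
    rw [hψχ z]
    field_simp

namespace BryantEnd

variable (E : BryantEnd)

theorem gauss_mul_omega {z : ℂ} (h : E.omega z ≠ 0) :
    E.D z * deriv E.A z - E.B z * deriv E.C z = E.gauss z * E.omega z := by
  unfold gauss
  field_simp

/-- In $F^{-1}dF$ the second column is $-g$ times the first, so the same relation holds between the
columns of $dF$. This ties the first-order term of $D$ to the pole of $C$. -/
theorem deriv_D_eq {z : ℂ} (hz : z ∈ E.disc) (h : E.omega z ≠ 0) :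
    deriv E.D z = -E.gauss z * deriv E.C z := by
  have h1 := E.det_eq z hz
  have h2 := E.deriv_det hz
  have h3 := E.null z hz
  have h4 := E.gauss_mul_omega h
  apply mul_left_cancel₀ h
  have h5 : -E.omega z * E.gauss z * deriv E.C z =
      -(E.D z * deriv E.A z - E.B z * deriv E.C z) * deriv E.C z := by rw [h4]; ring
  rw [neg_mul, mul_neg, ← mul_assoc, ← neg_mul, ← neg_mul, h5]
  unfold omega
  linear_combination deriv E.C z * h2 - E.C z * h3

/-- The coefficient of `dz` in the one-form `B dA - A dB`. -/
def form₂ (z : ℂ) : ℂ := E.B z * deriv E.A z - E.A z * deriv E.B z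

/-- The coefficient of `dz` in the one-form `C dB - D dA`. -/
def form₁ (z : ℂ) : ℂ := E.C z * deriv E.B z - E.D z * deriv E.A z

/-- The coefficient of `dz` in the one-form `D dC - C dD`. -/
def form₀ (z : ℂ) : ℂ := E.D z * deriv E.C z - E.C z * deriv E.D z

/-- The behaviour at the puncture of the forms and the Weierstrass data of a canonical end. -/
theorem IsCanonicalHorospherical.exists_expansions {E : BryantEnd}
    (hE : E.IsCanonicalHorospherical) :
    ∃ (μ : ℕ) (h w₂ w₁ k : ℂ → ℂ), 2 ≤ μ ∧ AnalyticAt ℂ h 0 ∧ h 0 ≠ 0 ∧ AnalyticAt ℂ w₂ 0 ∧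
      AnalyticAt ℂ w₁ 0 ∧ AnalyticAt ℂ k 0 ∧ (deriv k 0 = 0 ↔ 3 ≤ μ) ∧
      ∀ᶠ z in 𝓝[≠] (0 : ℂ), E.gauss z = z ^ μ ∧ E.omega z = (z ^ 2)⁻¹ * h z ∧
        E.form₂ z = w₂ z ∧ E.form₁ z = w₁ z ∧ E.form₀ z = k z / z ^ 2 := by
  obtain ⟨μ, h, f₁, f₂, g₁, g₂, b, c, hμ, hb, hc, ha, h0, hf₁, hf₁0, hf₂, hf₂0, hg₁, hg₁0, hg₂,
    hg₂0, hev⟩ := hE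
  obtain ⟨m, rfl⟩ := Nat.exists_eq_add_of_le hμ
  set β : ℂ → ℂ := fun z => b * z ^ (2 * m + 1) * g₂ z with hβdef
  have hβ : AnalyticAt ℂ β 0 := (analyticAt_const.mul (analyticAt_id.pow _)).mul hg₂
  have hevB : ∀ᶠ z in 𝓝[≠] (0 : ℂ), E.B z = z ^ 2 * β z := by
    filter_upwards [hev] with z hz
    rw [hz.2.2.2.1, hβdef, show 2 * (2 + m) - 1 = 2 + (2 * m + 1) by omega, pow_add]
    ring
  have hder : ∀ {f g : ℂ → ℂ}, (∀ᶠ z in 𝓝[≠] (0 : ℂ), f z = g z) →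
      ∀ᶠ z in 𝓝[≠] (0 : ℂ), deriv f z = deriv g z := by
    intro f g hfg
    filter_upwards [eventually_nhds_of_eventually_nhdsNE hfg] with z hz
    exact EventuallyEq.deriv_eq hz
  have hA' := hder (hev.mono fun z hz => hz.2.2.1)
  have hC' := hder (hev.mono fun z hz => hz.2.2.2.2.1)
  have hD' := hder (hev.mono fun z hz => hz.2.2.2.2.2)
  have hB' := hder hevB
  have hdB : ∀ᶠ z in 𝓝[≠] (0 : ℂ),
      deriv (fun z => z ^ 2 * β z) z = 2 * z * β z + z ^ 2 * deriv β z := by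
    filter_upwards [hβ.eventually_analyticAt.filter_mono nhdsWithin_le_nhds] with z hz
    have := (((hasDerivAt_id z).pow 2).mul hz.differentiableAt.hasDerivAt).deriv
    refine this.trans ?_
    simp
  have hdC : ∀ᶠ z in 𝓝[≠] (0 : ℂ),
      deriv (fun z => c * z⁻¹ * f₁ z) z = c * (z * deriv f₁ z - f₁ z) / z ^ 2 := by
    filter_upwards [hf₁.eventually_analyticAt.filter_mono nhdsWithin_le_nhds,
      self_mem_nhdsWithin] with z hz hz0
    have hz0' : z ≠ 0 := hz0
    have := (((hasDerivAt_inv hz0').const_mul c).mul hz.differentiableAt.hasDerivAt).deriv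
    refine this.trans ?_
    field_simp
    ring
  have hhne : ∀ᶠ z in 𝓝[≠] (0 : ℂ), h z ≠ 0 :=
    (ha.continuousAt.eventually_ne h0).filter_mono nhdsWithin_le_nhds
  -- Substituting $g=z^\mu$ and the simple pole of $C$ into $D'=-gC'$ gives
  -- $g_1'=c\,z^{\mu-2}(f_1-zf_1')$. With $m=\mu-2$, the factor $0^m$ separates $\mu=2$ from
  -- $\mu\ge3$.
  have hg₁' : deriv g₁ 0 = c * 0 ^ m := by
    have e : ∀ᶠ z in 𝓝[≠] (0 : ℂ), deriv g₁ z = z ^ m * c * (f₁ z - z * deriv f₁ z) := by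
      filter_upwards [hev, hC', hD', hdC, hhne, self_mem_nhdsWithin, E.disc_mem_nhdsNE]
        with z h1 h2 h3 h4 h5 h6 h7
      have h6' : z ≠ 0 := h6
      have hω : E.omega z ≠ 0 := by
        rw [h1.2.1]
        exact mul_ne_zero (inv_ne_zero (pow_ne_zero 2 h6')) h5
      have := E.deriv_D_eq h7 hω
      rw [h3, h2, h4, h1.1] at this
      rw [this, pow_add]
      field_simp
      ring
    have l1 : Tendsto (deriv g₁) (𝓝[≠] 0) (𝓝 (deriv g₁ 0)) :=
      hg₁.deriv.continuousAt.tendsto.mono_left nhdsWithin_le_nhds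
    have l2 : Tendsto (fun z => z ^ m * c * (f₁ z - z * deriv f₁ z)) (𝓝[≠] 0)
        (𝓝 ((0 : ℂ) ^ m * c * (f₁ 0 - 0 * deriv f₁ 0))) :=
      ((((analyticAt_id.pow m).mul analyticAt_const).mul
        (hf₁.sub (analyticAt_id.mul hf₁.deriv))).continuousAt.tendsto).mono_left nhdsWithin_le_nhds
    have := tendsto_nhds_unique l1 (l2.congr' (e.mono fun z hz => hz.symm))
    rw [this, hf₁0]
    ring
  refine ⟨2 + m, h, fun z => z ^ 2 * β z * deriv f₂ z - f₂ z * (2 * z * β z + z ^ 2 * deriv β z),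
    fun z => c * f₁ z * (2 * β z + z * deriv β z) - g₁ z * deriv f₂ z,
    fun z => c * (z * (g₁ z * deriv f₁ z - f₁ z * deriv g₁ z) - g₁ z * f₁ z),
    hμ, ha, h0, ?_, ?_, ?_, ?_, ?_⟩
  · have := hf₂.deriv
    have := hβ.deriv
    fun_prop
  · have := hf₂.deriv
    have := hβ.deriv
    fun_prop
  · have := hf₁.deriv
    have := hg₁.deriv
    fun_prop
  · have d1 := hf₁.differentiableAt.hasDerivAt
    have d2 := hg₁.differentiableAt.hasDerivAt
    have d := (((hasDerivAt_id (0 : ℂ)).mul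
      ((d2.mul hf₁.deriv.differentiableAt.hasDerivAt).sub
        (d1.mul hg₁.deriv.differentiableAt.hasDerivAt))).sub (d2.mul d1)).const_mul c
    -- The derivative of $f_1$ cancels, leaving $-2c\,g_1'(0)$.
    have e : deriv (fun z => c * (z * (g₁ z * deriv f₁ z - f₁ z * deriv g₁ z) - g₁ z * f₁ z)) 0 =
        -2 * c ^ 2 * 0 ^ m := by
      refine d.deriv.trans ?_
      simp [hf₁0, hg₁0, hg₁']
      ring
    rw [e]
    rcases Nat.eq_zero_or_pos m with rfl | hm
    · simpa using hc
    · simp [hm.ne']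
      omega
  · filter_upwards [hev, hevB, hA', hB', hC', hD', hdB, hdC, self_mem_nhdsWithin]
      with z h1 h2 h3 h4 h5 h6 h7 h8 h9
    have h9' : z ≠ 0 := h9
    obtain ⟨e1, e2, e3, e4, e5, e6⟩ := h1
    refine ⟨e1, e2, ?_, ?_, ?_⟩
    · rw [form₂, h3, h4, h7, h2, e3]
    · rw [form₁, h3, h4, h7, e5, e6]
      field_simp
    · rw [form₀, h5, h6, h8, e5, e6]
      field_simp
      ring

end BryantEnd

/-! ### Transformation of the forms and of the Weierstrass data under congruence. -/

namespace BryantEnd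

variable (E : BryantEnd)

/-- The expansion is known only near the puncture, whereas the loops range over the whole punctured
disc. Setting $k=z^2\theta$ away from zero propagates it. -/
theorem exists_double_pole_extension {θ K : ℂ → ℂ} (hθ : DifferentiableOn ℂ θ E.disc)
    (hK : AnalyticAt ℂ K 0) (h : ∀ᶠ z in 𝓝[≠] (0 : ℂ), θ z = K z / z ^ 2) :
    ∃ k : ℂ → ℂ, DifferentiableOn ℂ k (Metric.ball 0 E.r) ∧ (∀ z ∈ E.disc, θ z = k z / z ^ 2) ∧
      deriv k 0 = deriv K 0 := by
  set k : ℂ → ℂ := Function.update (fun z => z ^ 2 * θ z) 0 (K 0) with hk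
  have hkK : k =ᶠ[𝓝 0] K := by
    rw [eventually_nhdsWithin_iff] at h
    filter_upwards [h] with z hz
    by_cases h0 : z = 0
    · rw [h0, hk, Function.update_self]
    · rw [hk, Function.update_of_ne h0, hz h0]
      field_simp
  refine ⟨k, fun z hz => ?_, fun z hz => ?_, hkK.deriv_eq⟩
  · by_cases h0 : z = 0
    · rw [h0]
      exact (hK.differentiableAt.congr_of_eventuallyEq hkK).differentiableWithinAt
    · have hd : z ∈ E.disc := ⟨hz, h0⟩
      have h1 : DifferentiableAt ℂ (fun z => z ^ 2 * θ z) z :=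
        (differentiableAt_id.pow 2).mul (hθ.differentiableAt (E.isOpen_disc.mem_nhds hd))
      refine (h1.congr_of_eventuallyEq ?_).differentiableWithinAt
      filter_upwards [isOpen_compl_singleton.mem_nhds h0] with y hy
      exact Function.update_of_ne hy _ _
  · have h0 : z ≠ 0 := hz.2
    rw [hk, Function.update_of_ne h0]
    field_simp

theorem differentiableOn_forms : DifferentiableOn ℂ E.form₂ E.disc ∧
    DifferentiableOn ℂ E.form₁ E.disc ∧ DifferentiableOn ℂ E.form₀ E.disc := by
  have hd : ∀ {f : ℂ → ℂ}, DifferentiableOn ℂ f E.disc → DifferentiableOn ℂ (deriv f) E.disc :=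
    fun hf => hf.deriv E.isOpen_disc
  exact ⟨(E.holB.mul (hd E.holA)).sub (E.holA.mul (hd E.holB)),
    (E.holC.mul (hd E.holB)).sub (E.holD.mul (hd E.holA)),
    (E.holD.mul (hd E.holC)).sub (E.holC.mul (hd E.holD))⟩

/-- The relation between the Bryant representations of two ends which are congruent near the
puncture, and between their derivatives. -/
structure LocalForm (E E₀ : BryantEnd) (p q s t u v : ℂ) (ψ : ℂ → ℂ) (z : ℂ) : Prop where
  mem : z ∈ E.disc
  mem₀ : ψ z ∈ E₀.disc
  A : E.A z = (p * E₀.A (ψ z) - s * E₀.C (ψ z)) * u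
    - (p * E₀.B (ψ z) - s * E₀.D (ψ z)) * conj v
  B : E.B z = (p * E₀.A (ψ z) - s * E₀.C (ψ z)) * v
    + (p * E₀.B (ψ z) - s * E₀.D (ψ z)) * conj u
  C : E.C z = (t * E₀.C (ψ z) - q * E₀.A (ψ z)) * u
    - (t * E₀.D (ψ z) - q * E₀.B (ψ z)) * conj v
  D : E.D z = (t * E₀.C (ψ z) - q * E₀.A (ψ z)) * v
    + (t * E₀.D (ψ z) - q * E₀.B (ψ z)) * conj u
  A' : deriv E.A z = ((p * deriv E₀.A (ψ z) - s * deriv E₀.C (ψ z)) * u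
    - (p * deriv E₀.B (ψ z) - s * deriv E₀.D (ψ z)) * conj v) * deriv ψ z
  B' : deriv E.B z = ((p * deriv E₀.A (ψ z) - s * deriv E₀.C (ψ z)) * v
    + (p * deriv E₀.B (ψ z) - s * deriv E₀.D (ψ z)) * conj u) * deriv ψ z
  C' : deriv E.C z = ((t * deriv E₀.C (ψ z) - q * deriv E₀.A (ψ z)) * u
    - (t * deriv E₀.D (ψ z) - q * deriv E₀.B (ψ z)) * conj v) * deriv ψ z
  D' : deriv E.D z = ((t * deriv E₀.C (ψ z) - q * deriv E₀.A (ψ z)) * v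
    + (t * deriv E₀.D (ψ z) - q * deriv E₀.B (ψ z)) * conj u) * deriv ψ z

theorem IsHorospherical.exists_localForm {E : BryantEnd} {B : OnePoint ℂ}
    (hE : E.IsHorospherical B) :
    ∃ E₀ : BryantEnd, E₀.IsCanonicalHorospherical ∧ ∃ (p q s t u v : ℂ) (ψ : ℂ → ℂ),
      p * t - q * s = 1 ∧ (∀ b : ℂ, B = (b : OnePoint ℂ) → s * b + t = 0) ∧ (B = ∞ → s = 0) ∧
      u * conj u + v * conj v = 1 ∧ AnalyticAt ℂ ψ 0 ∧ ψ 0 = 0 ∧ deriv ψ 0 ≠ 0 ∧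
      ∀ᶠ z in 𝓝[≠] (0 : ℂ), LocalForm E E₀ p q s t u v ψ z := by
  obtain ⟨E₀, hE₀, p, q, s, t, u, v, ψ, hP, hB, hB', huv, hψ, hψ0, hψ', hloc⟩ := hE.exists_local_form
  refine ⟨E₀, hE₀, p, q, s, t, u, v, ψ, hP, hB, hB', huv, hψ, hψ0, hψ', ?_⟩
  have hψt := tendsto_nhdsNE_of_deriv_ne_zero hψ hψ0 hψ'
  have hz0 : ∀ᶠ z in 𝓝[≠] (0 : ℂ), ψ z ∈ E₀.disc := hψt.eventually E₀.disc_mem_nhdsNE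
  have hψd : ∀ᶠ z in 𝓝[≠] (0 : ℂ), DifferentiableAt ℂ ψ z :=
    (hψ.eventually_analyticAt.mono fun z hz => hz.differentiableAt).filter_mono nhdsWithin_le_nhds
  filter_upwards [hloc, eventually_nhds_of_eventually_nhdsNE hloc, hz0, hψd, E.disc_mem_nhdsNE]
    with z h1 h2 h3 h4 h5
  have d0 : ∀ {f : ℂ → ℂ}, DifferentiableOn ℂ f E₀.disc →
      HasDerivAt (fun z => f (ψ z)) (deriv f (ψ z) * deriv ψ z) z := fun hf =>
    (E₀.hasDerivAt_of_differentiableOn hf h3).comp z h4.hasDerivAt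
  have a := d0 E₀.holA
  have b := d0 E₀.holB
  have c := d0 E₀.holC
  have d := d0 E₀.holD
  have eA := (((a.const_mul p).sub (c.const_mul s)).mul_const u).sub
    (((b.const_mul p).sub (d.const_mul s)).mul_const (conj v))
  have eB := (((a.const_mul p).sub (c.const_mul s)).mul_const v).add
    (((b.const_mul p).sub (d.const_mul s)).mul_const (conj u))
  have eC := (((c.const_mul t).sub (a.const_mul q)).mul_const u).sub
    (((d.const_mul t).sub (b.const_mul q)).mul_const (conj v))
  have eD := (((c.const_mul t).sub (a.const_mul q)).mul_const v).add
    (((d.const_mul t).sub (b.const_mul q)).mul_const (conj u))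
  refine ⟨h5, h3, h1.1, h1.2.1, h1.2.2.1, h1.2.2.2, ?_, ?_, ?_, ?_⟩
  · rw [(eA.congr_of_eventuallyEq (h2.mono fun y hy => hy.1)).deriv]
    ring
  · rw [(eB.congr_of_eventuallyEq (h2.mono fun y hy => hy.2.1)).deriv]
    ring
  · rw [(eC.congr_of_eventuallyEq (h2.mono fun y hy => hy.2.2.1)).deriv]
    ring
  · rw [(eD.congr_of_eventuallyEq (h2.mono fun y hy => hy.2.2.2)).deriv]
    ring

variable {E} {E₀ : BryantEnd} {p q s t u v z : ℂ} {ψ : ℂ → ℂ}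

/-- Up to sign the three forms are the entries of $dF\,F^{-1}$. A constant right factor drops out,
its determinant being $|u|^2+|v|^2=1$, and the left factor conjugates; the derivative of the
determinant merges the two diagonal entries. -/
theorem LocalForm.form₂ (h : LocalForm E E₀ p q s t u v ψ z) (huv : u * conj u + v * conj v = 1) :
    E.form₂ z = (p ^ 2 * E₀.form₂ (ψ z) + 2 * p * s * E₀.form₁ (ψ z)
      + s ^ 2 * E₀.form₀ (ψ z)) * deriv ψ z := by
  have h2 := E₀.deriv_det h.mem₀
  simp only [BryantEnd.form₂, BryantEnd.form₁, BryantEnd.form₀, h.A, h.B, h.A', h.B']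
  linear_combination
    ((p * E₀.B (ψ z) - s * E₀.D (ψ z)) * (p * deriv E₀.A (ψ z) - s * deriv E₀.C (ψ z))
      - (p * E₀.A (ψ z) - s * E₀.C (ψ z)) * (p * deriv E₀.B (ψ z) - s * deriv E₀.D (ψ z)))
      * deriv ψ z * huv + p * s * deriv ψ z * h2

theorem LocalForm.form₁ (h : LocalForm E E₀ p q s t u v ψ z)
    (huv : u * conj u + v * conj v = 1) :
    E.form₁ z = (p * q * E₀.form₂ (ψ z) + (p * t + q * s) * E₀.form₁ (ψ z)
      + s * t * E₀.form₀ (ψ z)) * deriv ψ z := by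
  have h2 := E₀.deriv_det h.mem₀
  simp only [BryantEnd.form₂, BryantEnd.form₁, BryantEnd.form₀, h.C, h.D, h.A', h.B']
  linear_combination
    ((t * E₀.C (ψ z) - q * E₀.A (ψ z)) * (p * deriv E₀.B (ψ z) - s * deriv E₀.D (ψ z))
      - (t * E₀.D (ψ z) - q * E₀.B (ψ z)) * (p * deriv E₀.A (ψ z) - s * deriv E₀.C (ψ z)))
      * deriv ψ z * huv + q * s * deriv ψ z * h2

theorem LocalForm.form₀ (h : LocalForm E E₀ p q s t u v ψ z) (huv : u * conj u + v * conj v = 1) :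
    E.form₀ z = (q ^ 2 * E₀.form₂ (ψ z) + 2 * q * t * E₀.form₁ (ψ z)
      + t ^ 2 * E₀.form₀ (ψ z)) * deriv ψ z := by
  have h2 := E₀.deriv_det h.mem₀
  simp only [BryantEnd.form₂, BryantEnd.form₁, BryantEnd.form₀, h.C, h.D, h.C', h.D']
  linear_combination
    ((t * E₀.D (ψ z) - q * E₀.B (ψ z)) * (t * deriv E₀.C (ψ z) - q * deriv E₀.A (ψ z))
      - (t * E₀.C (ψ z) - q * E₀.A (ψ z)) * (t * deriv E₀.D (ψ z) - q * deriv E₀.B (ψ z)))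
      * deriv ψ z * huv + q * t * deriv ψ z * h2

/-- This supplies the remaining entry of $F^{-1}dF$. It comes from the nullity of $dF$, which makes
the determinant of $F^{-1}dF$ zero. -/
theorem gauss_sq_mul_omega (E : BryantEnd) {z : ℂ} (hz : z ∈ E.disc) (h : E.omega z ≠ 0) :
    E.B z * deriv E.D z - E.D z * deriv E.B z = E.gauss z ^ 2 * E.omega z := by
  have h2 := E.deriv_det hz
  have h3 := E.null z hz
  have h4 := E.gauss_mul_omega h
  apply mul_left_cancel₀ h
  have e : E.omega z * (E.gauss z ^ 2 * E.omega z) = (E.gauss z * E.omega z) ^ 2 := by ring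
  rw [e, ← h4]
  unfold BryantEnd.omega
  linear_combination (E.A z * E.D z - E.B z * E.C z) * h3
    - (E.D z * deriv E.A z - E.B z * deriv E.C z) * h2

/-- $F^{-1}dF$ ignores the left factor and is conjugated by the constant unitary matrix, so $\omega$
becomes a quadratic expression in $g$ times the original $\omega$, here a perfect square. -/
theorem LocalForm.omega (h : LocalForm E E₀ p q s t u v ψ z) (hP : p * t - q * s = 1)
    (hω : E₀.omega (ψ z) ≠ 0) :
    E.omega z = E₀.omega (ψ z) * (u + conj v * E₀.gauss (ψ z)) ^ 2 * deriv ψ z := by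
  have h2 := E₀.deriv_det h.mem₀
  have h4 := E₀.gauss_mul_omega hω
  have h5 := E₀.gauss_sq_mul_omega h.mem₀ hω
  have e : E₀.omega (ψ z) * (u + conj v * E₀.gauss (ψ z)) ^ 2 * deriv ψ z =
      (u ^ 2 * E₀.omega (ψ z) + 2 * u * conj v * (E₀.gauss (ψ z) * E₀.omega (ψ z))
        + conj v ^ 2 * (E₀.gauss (ψ z) ^ 2 * E₀.omega (ψ z))) * deriv ψ z := by ring
  rw [e, ← h4, ← h5]
  simp only [BryantEnd.omega, h.A, h.C, h.A', h.C']
  generalize E₀.A (ψ z) = A at *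
  generalize E₀.B (ψ z) = B at *
  generalize E₀.C (ψ z) = C at *
  generalize E₀.D (ψ z) = D at *
  generalize deriv E₀.A (ψ z) = A' at *
  generalize deriv E₀.B (ψ z) = B' at *
  generalize deriv E₀.C (ψ z) = C' at *
  generalize deriv E₀.D (ψ z) = D' at *
  linear_combination (u ^ 2 * (A * C' - C * A') + u * conj v * (D * A' - B * C' - A * D' + C * B')
    + conj v ^ 2 * (B * D' - D * B')) * deriv ψ z * hP - u * conj v * deriv ψ z * h2

theorem LocalForm.gauss (h : LocalForm E E₀ p q s t u v ψ z) (hP : p * t - q * s = 1)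
    (hω : E₀.omega (ψ z) ≠ 0) (hψ : deriv ψ z ≠ 0) :
    E.gauss z = (conj u * E₀.gauss (ψ z) - v) / (u + conj v * E₀.gauss (ψ z)) := by
  have h2 := E₀.deriv_det h.mem₀
  have h4 := E₀.gauss_mul_omega hω
  have h5 := E₀.gauss_sq_mul_omega h.mem₀ hω
  have hnum : E.D z * deriv E.A z - E.B z * deriv E.C z = E₀.omega (ψ z) *
      (conj u * E₀.gauss (ψ z) - v) * (u + conj v * E₀.gauss (ψ z)) * deriv ψ z := by
    have e : E₀.omega (ψ z) *
      (conj u * E₀.gauss (ψ z) - v) * (u + conj v * E₀.gauss (ψ z)) * deriv ψ z =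
      (-u * v * E₀.omega (ψ z) + (u * conj u - v * conj v) * (E₀.gauss (ψ z) * E₀.omega (ψ z))
        + conj u * conj v * (E₀.gauss (ψ z) ^ 2 * E₀.omega (ψ z))) * deriv ψ z := by ring
    rw [e, ← h4, ← h5]
    simp only [BryantEnd.omega, h.B, h.D, h.A', h.C']
    generalize E₀.A (ψ z) = A at *
    generalize E₀.B (ψ z) = B at *
    generalize E₀.C (ψ z) = C at *
    generalize E₀.D (ψ z) = D at *
    generalize deriv E₀.A (ψ z) = A' at *
    generalize deriv E₀.B (ψ z) = B' at *
    generalize deriv E₀.C (ψ z) = C' at *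
    generalize deriv E₀.D (ψ z) = D' at *
    linear_combination (-u * v * (A * C' - C * A') + u * conj u * (D * A' - B * C')
      + v * conj v * (A * D' - C * B') + conj u * conj v * (B * D' - D * B')) * deriv ψ z * hP
      + v * conj v * deriv ψ z * h2
  rw [BryantEnd.gauss, hnum, h.omega hP hω]
  field_simp

/-! ### Hopf differential and degree of the secondary Gauss map. -/

/-- The Weierstrass data of a horospherical end near the puncture. -/
theorem eventually_gauss_and_hopf {μ : ℕ} {h : ℂ → ℂ} (hμ : 2 ≤ μ) (hh : AnalyticAt ℂ h 0)
    (hh0 : h 0 ≠ 0)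
    (hE₀ : ∀ᶠ z in 𝓝[≠] (0 : ℂ), E₀.gauss z = z ^ μ ∧ E₀.omega z = (z ^ 2)⁻¹ * h z)
    (hP : p * t - q * s = 1) (huv : u * conj u + v * conj v = 1)
    (hψ : AnalyticAt ℂ ψ 0) (hψ0 : ψ 0 = 0) (hψ' : deriv ψ 0 ≠ 0)
    (hloc : ∀ᶠ z in 𝓝[≠] (0 : ℂ), LocalForm E E₀ p q s t u v ψ z) :
    (∀ᶠ z in 𝓝[≠] (0 : ℂ), u + conj v * ψ z ^ μ ≠ 0 ∧
      E.gauss z = (conj u * ψ z ^ μ - v) / (u + conj v * ψ z ^ μ)) ∧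
    ∀ᶠ z in 𝓝[≠] (0 : ℂ), E.hopf z = μ * h (ψ z) * deriv ψ z ^ 2 * (ψ z ^ (μ - 1) / ψ z ^ 2) := by
  have hψt := tendsto_nhdsNE_of_deriv_ne_zero hψ hψ0 hψ'
  have hψne : ∀ᶠ z in 𝓝[≠] (0 : ℂ), ψ z ≠ 0 := hψt.eventually self_mem_nhdsWithin
  have hhne : ∀ᶠ z in 𝓝[≠] (0 : ℂ), h (ψ z) ≠ 0 := hψt.eventually
    ((hh.continuousAt.eventually_ne hh0).filter_mono nhdsWithin_le_nhds)
  have hψ'ne : ∀ᶠ z in 𝓝[≠] (0 : ℂ), deriv ψ z ≠ 0 :=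
    (hψ.deriv.continuousAt.eventually_ne hψ').filter_mono nhdsWithin_le_nhds
  -- If $u=0$ the denominator vanishes at the puncture itself, but not nearby, since then $v\ne0$.
  have hden : ∀ᶠ z in 𝓝[≠] (0 : ℂ), u + conj v * ψ z ^ μ ≠ 0 := by
    by_cases hu : u = 0
    · have hv : conj v ≠ 0 := by
        intro hv
        rw [hu, hv] at huv
        simp at huv
      filter_upwards [hψne] with z hz
      rw [hu, zero_add]
      exact mul_ne_zero hv (pow_ne_zero _ hz)
    · have hc : ContinuousAt (fun z => u + conj v * ψ z ^ μ) 0 :=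
        (analyticAt_const.add (analyticAt_const.mul (hψ.pow μ))).continuousAt
      refine (hc.eventually_ne ?_).filter_mono nhdsWithin_le_nhds
      have : μ ≠ 0 := by omega
      simpa [hψ0, this] using hu
  have hg : ∀ᶠ z in 𝓝[≠] (0 : ℂ),
      E.gauss z = (conj u * ψ z ^ μ - v) / (u + conj v * ψ z ^ μ) := by
    filter_upwards [hloc, hψt.eventually hE₀, hψne, hhne, hψ'ne] with z h1 h2 h3 h4 h5
    have hω : E₀.omega (ψ z) ≠ 0 := by
      rw [h2.2]
      exact mul_ne_zero (inv_ne_zero (pow_ne_zero 2 h3)) h4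
    rw [← h2.1]
    exact h1.gauss hP hω h5
  refine ⟨hden.and hg, ?_⟩
  filter_upwards [hloc, hψt.eventually hE₀, hψne, hhne, hψ'ne, hden,
    eventually_nhds_of_eventually_nhdsNE hg,
    hψ.eventually_analyticAt.filter_mono nhdsWithin_le_nhds] with z h1 h2 h3 h4 h5 h6 h7 h8
  have hω : E₀.omega (ψ z) ≠ 0 := by
    rw [h2.2]
    exact mul_ne_zero (inv_ne_zero (pow_ne_zero 2 h3)) h4
  have d := h8.differentiableAt.hasDerivAt.pow μ
  have dq := ((d.const_mul (conj u)).sub_const v).div ((d.const_mul (conj v)).const_add u) h6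
  have dg : deriv E.gauss z = _ := (dq.congr_of_eventuallyEq h7).deriv
  rw [hopf, dg, h1.omega hP hω, h2.1, h2.2]
  simp only [Pi.pow_apply]
  field_simp
  -- The derivative of the unitary Möbius map has numerator $|u|^2+|v|^2=1$, and its squared
  -- denominator cancels the factor in $\omega$.
  linear_combination (μ : ℂ) * huv

/-- Up to a nonvanishing factor the Hopf differential is $\psi^{\mu-3}$. For $\mu=2$, a holomorphic
extension multiplied by $\psi$ would tend to zero, while the formula gives a nonzero limit. -/
theorem hopfHolomorphicAtZero_iff {μ : ℕ} {h : ℂ → ℂ} (hμ : 2 ≤ μ) (hh : AnalyticAt ℂ h 0)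
    (hh0 : h 0 ≠ 0) (hψ : AnalyticAt ℂ ψ 0) (hψ0 : ψ 0 = 0) (hψ' : deriv ψ 0 ≠ 0)
    (hq : ∀ᶠ z in 𝓝[≠] (0 : ℂ),
      E.hopf z = μ * h (ψ z) * deriv ψ z ^ 2 * (ψ z ^ (μ - 1) / ψ z ^ 2)) :
    E.HopfHolomorphicAtZero ↔ 3 ≤ μ := by
  have hψt := tendsto_nhdsNE_of_deriv_ne_zero hψ hψ0 hψ'
  have hψne : ∀ᶠ z in 𝓝[≠] (0 : ℂ), ψ z ≠ 0 := hψt.eventually self_mem_nhdsWithin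
  have hhψ : AnalyticAt ℂ (fun z => h (ψ z)) 0 := AnalyticAt.comp (by rwa [hψ0]) hψ
  constructor
  · rintro ⟨Q, hQ, hQe⟩
    by_contra hlt
    obtain rfl : μ = 2 := by omega
    have e : ∀ᶠ z in 𝓝[≠] (0 : ℂ), Q z * ψ z = 2 * h (ψ z) * deriv ψ z ^ 2 := by
      filter_upwards [hq, hQe, hψne] with z h1 h2 h3
      rw [← h2, h1]
      push_cast
      field_simp
    have l1 : Tendsto (fun z => Q z * ψ z) (𝓝[≠] 0) (𝓝 (Q 0 * ψ 0)) :=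
      (hQ.mul hψ).continuousAt.tendsto.mono_left nhdsWithin_le_nhds
    have l2 : Tendsto (fun z => 2 * h (ψ z) * deriv ψ z ^ 2) (𝓝[≠] 0)
        (𝓝 (2 * h (ψ 0) * deriv ψ 0 ^ 2)) :=
      ((analyticAt_const.mul hhψ).mul (hψ.deriv.pow 2)).continuousAt.tendsto.mono_left
        nhdsWithin_le_nhds
    have := tendsto_nhds_unique l1 (l2.congr' (e.mono fun z hz => hz.symm))
    rw [hψ0, mul_zero] at this
    exact mul_ne_zero (mul_ne_zero two_ne_zero hh0) (pow_ne_zero 2 hψ') this.symm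
  · intro h3
    refine ⟨fun z => μ * h (ψ z) * deriv ψ z ^ 2 * ψ z ^ (μ - 3), ?_, ?_⟩
    · exact ((analyticAt_const.mul hhψ).mul (hψ.deriv.pow 2)).mul (hψ.pow _)
    · filter_upwards [hq, hψne] with z h1 h2
      rw [h1, show μ - 1 = (μ - 3) + 2 by omega, pow_add]
      field_simp

/-- Composition with a Möbius map preserves local multiplicity. The value at the puncture is $-v/u$,
or $\infty$ when $u=0$, which explains the two cases. -/
theorem hasDegreeAtZero_gauss {μ : ℕ} (hμ : 2 ≤ μ) (huv : u * conj u + v * conj v = 1)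
    (hψ : AnalyticAt ℂ ψ 0) (hψ0 : ψ 0 = 0) (hψ' : deriv ψ 0 ≠ 0)
    (hg : ∀ᶠ z in 𝓝[≠] (0 : ℂ), u + conj v * ψ z ^ μ ≠ 0 ∧
      E.gauss z = (conj u * ψ z ^ μ - v) / (u + conj v * ψ z ^ μ)) :
    HasDegreeAtZero E.gauss μ := by
  have hψt := tendsto_nhdsNE_of_deriv_ne_zero hψ hψ0 hψ'
  have hψne : ∀ᶠ z in 𝓝[≠] (0 : ℂ), ψ z ≠ 0 := hψt.eventually self_mem_nhdsWithin
  set χ : ℂ → ℂ := dslope ψ 0 with hχdef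
  have hχ : AnalyticAt ℂ χ 0 := by
    obtain ⟨p, hp⟩ := hψ
    exact ⟨_, hp.has_fpower_series_dslope_fslope⟩
  have hψχ : ∀ z, ψ z = z * χ z := by
    intro z
    have := sub_smul_dslope ψ 0 z
    rw [hψ0, sub_zero, sub_zero, smul_eq_mul] at this
    exact this.symm
  have hχ0 : χ 0 ≠ 0 := by rwa [hχdef, dslope_same]
  have horder : ∀ {f G : ℂ → ℂ} {n : ℤ}, AnalyticAt ℂ G 0 → G 0 ≠ 0 →
      (∀ᶠ z in 𝓝[≠] (0 : ℂ), f z = z ^ n * G z) → meromorphicOrderAt f 0 = (n : WithTop ℤ) := by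
    intro f G n hG hG0 hf
    have hmer : MeromorphicAt f 0 := by
      refine MeromorphicAt.congr (((MeromorphicAt.id 0).zpow n).mul hG.meromorphicAt) ?_
      exact hf.mono fun z hz => hz.symm
    rw [meromorphicOrderAt_eq_int_iff hmer]
    exact ⟨G, hG, hG0, hf.mono fun z hz => by rw [hz, sub_zero, smul_eq_mul]⟩
  refine ⟨by omega, ?_⟩
  have hμ0 : μ ≠ 0 := by omega
  by_cases hu : u = 0
  · left
    have hv : v ≠ 0 ∧ conj v ≠ 0 := by
      constructor <;> intro hv <;> rw [hu, hv] at huv <;> simp at huv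
    refine horder (G := fun z => -v / (conj v * χ z ^ μ))
      (analyticAt_const.div (analyticAt_const.mul (hχ.pow μ))
        (mul_ne_zero hv.2 (pow_ne_zero _ hχ0)))
      (div_ne_zero (neg_ne_zero.mpr hv.1) (mul_ne_zero hv.2 (pow_ne_zero _ hχ0))) ?_
    filter_upwards [hg, hψne, self_mem_nhdsWithin] with z h1 h2 h3
    rw [h1.2, hu, map_zero, zero_mul, zero_sub, zero_add, hψχ z, mul_pow, zpow_neg, zpow_natCast]
    have h3' : z ≠ 0 := h3
    have h4 : χ z ≠ 0 := fun h4 => h2 (by rw [hψχ, h4, mul_zero])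
    have := hv.2
    field_simp
  · right
    refine ⟨-v / u, ?_⟩
    have hden : u * (u + conj v * ψ 0 ^ μ) ≠ 0 := by
      rw [hψ0, zero_pow hμ0, mul_zero, add_zero]
      exact mul_ne_zero hu hu
    refine horder (G := fun z => χ z ^ μ / (u * (u + conj v * ψ z ^ μ)))
      ((hχ.pow μ).div (analyticAt_const.mul
        (analyticAt_const.add (analyticAt_const.mul (hψ.pow μ)))) hden)
      (div_ne_zero (pow_ne_zero _ hχ0) hden) ?_
    filter_upwards [hg] with z h1
    have h2 := h1.1
    rw [h1.2, zpow_natCast, mul_div_assoc', ← mul_pow, ← hψχ z]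
    rw [div_sub_div _ _ h2 hu, div_eq_div_iff (mul_ne_zero h2 hu) (mul_ne_zero hu h2)]
    linear_combination ψ z ^ μ * (u + conj v * ψ z ^ μ) * u * huv

end BryantEnd

/-! ### Evaluation of axis fields at the boundary point, and the theorem. -/

/-- The holomorphic field of the translation vanishes at both ends of the axis. For finite ends it
is $(\zeta-C)(\zeta-D)/(C-D)$, with derivative $1$ at the starting point $C$; the kernel is its
value at $b$. -/
theorem axisCoeff_some (b : ℂ) {C D : OnePoint ℂ} (h : C ≠ D) :
    (H3.axisCoeff C D).2.1 + 2 * (H3.axisCoeff C D).1 * b - (H3.axisCoeff C D).2.2 * b ^ 2 =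
      fluxKernel (b : OnePoint ℂ) C D := by
  induction C using OnePoint.rec <;> induction D using OnePoint.rec
  · exact absurd rfl h
  · simp [H3.axisCoeff, H3.axisMatrix, fluxKernel, Matrix.det_fin_two]
    ring
  · simp [H3.axisCoeff, H3.axisMatrix, fluxKernel, Matrix.det_fin_two]
    ring
  · rename_i c d
    have h1 : d - c ≠ 0 := fun e => h (by rw [sub_eq_zero.mp e])
    have h2 : c - d ≠ 0 := fun e => h (by rw [sub_eq_zero.mp e])
    simp [H3.axisCoeff, H3.axisMatrix, fluxKernel, Matrix.det_fin_two]
    field_simp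
    ring

/-- At the boundary point $\infty$, evaluation of the quadratic field becomes its leading
coefficient. -/
theorem axisCoeff_infty {C D : OnePoint ℂ} (h : C ≠ D) :
    -(H3.axisCoeff C D).2.2 = fluxKernel ∞ C D := by
  induction C using OnePoint.rec <;> induction D using OnePoint.rec
  · exact absurd rfl h
  · simp [H3.axisCoeff, H3.axisMatrix, fluxKernel, Matrix.det_fin_two]
  · simp [H3.axisCoeff, H3.axisMatrix, fluxKernel, Matrix.det_fin_two]
  · rename_i c d
    have h1 : d - c ≠ 0 := fun e => h (by rw [sub_eq_zero.mp e])
    have h2 : c - d ≠ 0 := fun e => h (by rw [sub_eq_zero.mp e])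
    simp [H3.axisCoeff, H3.axisMatrix, fluxKernel, Matrix.det_fin_two]
    field_simp
    ring

end

theorem theorem5p2 (E : BryantEnd) (B : OnePoint ℂ) (hE : E.IsHorospherical B) :
    ∃ κ : ℂ,
      (∀ C D : OnePoint ℂ, C ≠ D →
        E.HasFlux (H3.translationField C D) (-2 * Real.pi * (κ * fluxKernel B C D).re) ∧
        E.HasFlux (H3.rotationField C D) (2 * Real.pi * (κ * fluxKernel B C D).im)) ∧
      (∀ b : ℂ, B = (b : OnePoint ℂ) →
        E.fluxPolynomial =
          Polynomial.C (-2 * Real.pi * κ) * (Polynomial.X - Polynomial.C b) ^ 2) ∧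
      (B = ∞ → E.fluxPolynomial = Polynomial.C (-2 * Real.pi * κ)) ∧
      (κ = 0 ↔ E.fluxPolynomial = 0) ∧
      (κ = 0 ↔ E.HopfHolomorphicAtZero) ∧
      ∃ μ : ℕ, HasDegreeAtZero E.gauss μ ∧ (κ = 0 ↔ 3 ≤ μ) := by
  obtain ⟨E₀, hE₀, p, q, s, t, u, v, ψ, hP, hB, hB', huv, hψ, hψ0, hψ', hloc⟩ := hE.exists_localForm
  obtain ⟨μ, h, w₂, w₁, k, hμ, hh, hh0, hw₂, hw₁, hk, hkμ, hexp⟩ := hE₀.exists_expansions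
  have hψt := tendsto_nhdsNE_of_deriv_ne_zero hψ hψ0 hψ'
  obtain ⟨hgauss, hhopf⟩ := BryantEnd.eventually_gauss_and_hopf hμ hh hh0
    (hexp.mono fun z hz => ⟨hz.1, hz.2.1⟩) hP huv hψ hψ0 hψ' hloc
  set ρ := deriv k 0 with hρ
  -- Only the coefficient of `form₀` contributes to the residue, the other two forms being
  -- holomorphic at the puncture of the canonical end.
  have hpole : ∀ {θ : ℂ → ℂ} {x₂ x₁ x₀ : ℂ}, DifferentiableOn ℂ θ E.disc →
      (∀ᶠ z in 𝓝[≠] (0 : ℂ), θ z = (x₂ * E₀.form₂ (ψ z) + x₁ * E₀.form₁ (ψ z)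
        + x₀ * E₀.form₀ (ψ z)) * deriv ψ z) →
      ∃ k : ℂ → ℂ, DifferentiableOn ℂ k (Metric.ball 0 E.r) ∧
        (∀ z ∈ E.disc, θ z = k z / z ^ 2) ∧ deriv k 0 = x₀ * ρ := by
    intro θ x₂ x₁ x₀ hθ hev
    obtain ⟨K, hK, hK', hKe⟩ := exists_double_pole_pullback
      (w := fun z => x₂ * w₂ z + x₁ * w₁ z)
      ((analyticAt_const.mul hw₂).add (analyticAt_const.mul hw₁)) hk hψ hψ0 hψ' x₀
    rw [← hK']
    refine E.exists_double_pole_extension hθ hK ?_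
    filter_upwards [hev, hKe, hψt.eventually hexp] with z h1 h2 h3
    rw [h1, ← h2, h3.2.2.1, h3.2.2.2.1, h3.2.2.2.2]
  obtain ⟨d₂, d₁, d₀⟩ := E.differentiableOn_forms
  obtain ⟨k₂, hk₂, hk₂e, hk₂'⟩ := hpole d₂ (hloc.mono fun z hz => hz.form₂ huv)
  obtain ⟨k₁, hk₁, hk₁e, hk₁'⟩ := hpole d₁ (hloc.mono fun z hz => hz.form₁ huv)
  obtain ⟨k₀, hk₀, hk₀e, hk₀'⟩ := hpole d₀ (hloc.mono fun z hz => hz.form₀ huv)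
  have hphi₂ : E.phi2 = 4 * Real.pi * (s ^ 2 * ρ) := by
    rw [← hk₂', ← E.residue_eq hk₂ hk₂e]
    rfl
  have hphi₁ : E.phi1 = 4 * Real.pi * (s * t * ρ) := by
    rw [← hk₁', ← E.residue_eq hk₁ hk₁e]
    rfl
  have hphi₀ : E.phi0 = 4 * Real.pi * (t ^ 2 * ρ) := by
    rw [← hk₀', ← E.residue_eq hk₀ hk₀e]
    rfl
  have hflux : ∀ (a b c : ℂ) (Y : ℂ × ℝ → ℂ × ℝ), (∀ x ∈ H3.space, Y x = H3.killing a b c x) →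
      E.HasFlux Y (4 * Real.pi * (ρ * (b * s ^ 2 - 2 * a * (s * t) - c * t ^ 2)).re) := by
    intro a b c Y hY
    have h0 : (0 : ℂ) ∈ Metric.ball (0 : ℂ) E.r := Metric.mem_ball_self E.r_pos
    have hd : ∀ {f : ℂ → ℂ}, DifferentiableOn ℂ f (Metric.ball 0 E.r) → HasDerivAt f (deriv f 0) 0 :=
      fun hf => (hf.differentiableAt E.ball_mem_nhds).hasDerivAt
    have hder : deriv (fun z => b * k₂ z - 2 * a * k₁ z - c * k₀ z) 0 =
        ρ * (b * s ^ 2 - 2 * a * (s * t) - c * t ^ 2) := by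
      have := ((((hd hk₂).const_mul b).sub ((hd hk₁).const_mul (2 * a))).sub
        ((hd hk₀).const_mul c)).deriv
      refine this.trans ?_
      rw [hk₂', hk₁', hk₀']
      ring
    rw [← hder]
    refine E.hasFlux_of_fluxForm_eq (a := a) (b := b) (c := c)
      (((hk₂.const_mul b).sub (hk₁.const_mul (2 * a))).sub (hk₀.const_mul c)) ?_ hY
    intro z hz
    have : E.fluxForm a b c z = b * E.form₂ z - 2 * a * E.form₁ z - c * E.form₀ z := rfl
    rw [this, hk₂e z hz, hk₁e z hz, hk₀e z hz]
    simp only [Pi.sub_apply]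
    ring
  -- Common argument for both kinds of boundary point: `m` will be $s^2$ or $t^2$, and
  -- $\kappa=-2\rho m$. The factor $-2$ turns $4\pi\rho m$ into $-2\pi\kappa$. For rotations, the
  -- extra $i$ turns the real part into minus the imaginary part.
  have main : ∀ m : ℂ, m ≠ 0 →
      (∀ C D : OnePoint ℂ, C ≠ D → (H3.axisCoeff C D).2.1 * s ^ 2
        - 2 * (H3.axisCoeff C D).1 * (s * t) - (H3.axisCoeff C D).2.2 * t ^ 2 =
          m * fluxKernel B C D) →
      (∀ C D : OnePoint ℂ, C ≠ D →
        E.HasFlux (H3.translationField C D)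
          (-2 * Real.pi * (-2 * (ρ * m) * fluxKernel B C D).re) ∧
        E.HasFlux (H3.rotationField C D)
          (2 * Real.pi * (-2 * (ρ * m) * fluxKernel B C D).im)) ∧
      (-2 * (ρ * m) = 0 ↔ E.HopfHolomorphicAtZero) ∧
      ∃ μ : ℕ, HasDegreeAtZero E.gauss μ ∧ (-2 * (ρ * m) = 0 ↔ 3 ≤ μ) := by
    intro m hm hax
    have hzero : -2 * (ρ * m) = 0 ↔ 3 ≤ μ := by
      rw [← hkμ]
      simp [hm]
    refine ⟨fun C D hCD => ⟨?_, ?_⟩, ?_, μ, ?_, hzero⟩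
    · have := hflux _ _ _ _ fun x hx => H3.translationField_eq hCD hx
      rw [hax C D hCD] at this
      convert this using 1
      have e : -2 * (ρ * m) * fluxKernel B C D = ((-2 : ℝ) : ℂ) * (ρ * (m * fluxKernel B C D)) := by
        push_cast
        ring
      rw [e, Complex.re_ofReal_mul]
      ring
    · have := hflux _ _ _ _ fun x hx => H3.rotationField_eq hCD hx
      have e' : I * (H3.axisCoeff C D).2.1 * s ^ 2 - 2 * (I * (H3.axisCoeff C D).1) * (s * t)
          - I * (H3.axisCoeff C D).2.2 * t ^ 2 = I * (m * fluxKernel B C D) := by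
        rw [← hax C D hCD]
        ring
      rw [e'] at this
      convert this using 1
      have e : -2 * (ρ * m) * fluxKernel B C D = ((-2 : ℝ) : ℂ) * (ρ * (m * fluxKernel B C D)) := by
        push_cast
        ring
      have e2 : ρ * (I * (m * fluxKernel B C D)) = I * (ρ * (m * fluxKernel B C D)) := by ring
      rw [e, e2, Complex.im_ofReal_mul, Complex.I_mul_re]
      ring
    · rw [hzero]
      exact (BryantEnd.hopfHolomorphicAtZero_iff hμ hh hh0 hψ hψ0 hψ' hhopf).symm
    · exact BryantEnd.hasDegreeAtZero_gauss hμ huv hψ hψ0 hψ' hgauss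
  have hpi : (Real.pi : ℂ) ≠ 0 := by exact_mod_cast Real.pi_ne_zero
  induction B using OnePoint.rec with
  | infty =>
    have hs : s = 0 := hB' rfl
    have ht : t ≠ 0 := by
      rintro rfl
      rw [hs] at hP
      simp at hP
    obtain ⟨m1, m2, m3⟩ := main (t ^ 2) (pow_ne_zero 2 ht) (by
      intro C D hCD
      rw [← axisCoeff_infty hCD, hs]
      ring)
    have hpoly : E.fluxPolynomial = Polynomial.C (-2 * Real.pi * (-2 * (ρ * t ^ 2))) := by
      rw [BryantEnd.fluxPolynomial, hphi₂, hphi₁, hphi₀, hs]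
      rw [show (4 * Real.pi * ((0 : ℂ) ^ 2 * ρ)) = 0 by ring,
        show 2 * (4 * Real.pi * (0 * t * ρ)) = 0 by ring]
      simp only [map_zero, zero_mul, zero_add]
      congr 1
      ring
    refine ⟨-2 * (ρ * t ^ 2), m1, fun b hb => absurd hb (OnePoint.infty_ne_coe b), fun _ => hpoly,
      ?_, m2, m3⟩
    rw [hpoly, Polynomial.C_eq_zero]
    simp [hpi]
  | coe b =>
    have ht : s * b + t = 0 := hB b rfl
    -- With this relation $(sX+t)^2=s^2(X-b)^2$, and the residue of the flux form is $s^2\rho$ times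
    -- the holomorphic field at $b$.
    have ht' : t = -(s * b) := by linear_combination ht
    have hs : s ≠ 0 := by
      rintro rfl
      rw [ht'] at hP
      simp at hP
    obtain ⟨m1, m2, m3⟩ := main (s ^ 2) (pow_ne_zero 2 hs) (by
      intro C D hCD
      rw [← axisCoeff_some b hCD, ht']
      ring)
    have hpoly : E.fluxPolynomial = Polynomial.C (-2 * Real.pi * (-2 * (ρ * s ^ 2)))
        * (Polynomial.X - Polynomial.C b) ^ 2 := by
      rw [BryantEnd.fluxPolynomial, hphi₂, hphi₁, hphi₀, ht']
      simp only [map_mul, map_neg, map_pow]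
      simp only [show (Polynomial.C (4 : ℂ)) = 4 from rfl, show (Polynomial.C (2 : ℂ)) = 2 from rfl]
      ring
    refine ⟨-2 * (ρ * s ^ 2), m1, ?_, fun hb => absurd hb (OnePoint.coe_ne_infty b), ?_, m2, m3⟩
    · intro b' hb'
      rw [← OnePoint.coe_injective hb']
      exact hpoly
    · rw [hpoly, mul_eq_zero (M₀ := Polynomial ℂ), Polynomial.C_eq_zero]
      simp [hpi, Polynomial.X_sub_C_ne_zero b]
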